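/- \textbf{Theorem 13 (maximum score in critical two-type processes).} Let $\mathbf Z(n)=(Z_1(n),Z_2(n))$, $n\ge 0$, be a two-type Galton--Watson process: $$Z_k(n)=\sum_{j=1}^{Z_1(n-1)}X^1_{kj}(n)+\sum_{j=1}^{Z_2(n-1)}X^2_{kj}(n),\qquad k=1,2,\ n\ge 1,$$ where the offspring vectors $(X^i_{1j}(n),X^i_{2j}(n))\in\mathbb Z_{\ge 0}^2$ are independent, with a law depending only on the parent's type $i$, and the initial vector $\mathbf Z(0)\neq\mathbf 0$ a.s. has finite mean and is independent of them. Let $(X^i_1,X^i_2)$ denote a generic offspring vector of a type $i$ parent, assume that its components have finite second moments, and let $\mathbf M=(E X^i_k)_{i,k}$ be the mean matrix. Assume that the process is positively regular (some power of $\mathbf M$ has only positive entries), nonsingular (it is not the case that every individual has exactly one child a.s.) and critical (the maximal eigenvalue of $\mathbf M$ is $1$). Let $\mathbf u$ and $\mathbf v$ be the right and left eigenvectors of $\mathbf M$ for the eigenvalue $1$ with $\mathbf u\cdot\mathbf v=1$ and $u_1+u_2=1$, and let $$2B=\sum_{i,j,k=1}^2 v_i\,E\big[X^i_j(X^i_k-\delta_{jk})\big]\,u_ju_k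 .$$ The $j$-th individual of type $i$ in generation $n$ carries a score $\zeta_{ij}(n)$. The scores are independent of each other and of the branching process, and those of type $i$ are nonnegative with a common continuous distribution function $F_i$. Assume: 1. (tail equivalence) $F_1$ and $F_2$ have the same right endpoint $x_0\le\infty$, and $\lim_{x\uparrow x_0}\frac{1-F_1(x)}{1-F_2(x)}=A$ for some $A\in(0,\infty)$; 2. (max-domain of attraction) for some $\theta\in[-\infty,\infty]\setminus\{0\}$ and some functions $a(t)>0$ (for large $t$) and $b(t)$ of a real variable, $F_1(a(t)x+b(t))^t\to H(x,\theta)=e^{-h(x,\theta)}$ as $t\to\infty$ for all $x\in\mathbb R$ (norming sequences $a_n,b_n$ are included through $a(t)=a_{\lfloor t\rfloor}$, $b(t)=b_{\lfloor t\rfloor}$). Here $h(x,\theta)=(1+x/\theta)^{-\theta}$ for finite $\theta$ and $1+x/\theta>0$; where $1+x/\theta\le 0$, $h(x,\theta)=\infty$ if $\theta>0$ and $h(x,\theta)=0$ if $\theta<0$; and $h(x,\pm\infty)=e^{-x}$. Let $\mathcal M_n^\zeta=\max\{\zeta_{ij}(n): i=1,2,\ 1\le j\le Z_i(n)\}$ be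 the maximum score in generation $n$. Then, for every $x\in\mathbb R$, $$\lim_{n\to\infty}P\left(\frac{\mathcal M_n^\zeta-b(v_1Bn)}{a(v_1Bn)}\le x\ \Big|\ \mathbf Z(n)\neq\mathbf 0\right)=\frac{1}{1+h(x,\theta)+(v_2/v_1)\,h(cx+d,\theta)}$$ (which is $0$ where $h=\infty$), where $c=A^{1/\theta}$ and $d=\theta\,(A^{1/\theta}-1)$ if $\theta$ is finite, and $c=1$, $d=\ln A$ if $\theta=\pm\infty$. The same limit holds if the maximum is taken over $1\le j\le Z_i(n-1)$ instead of $1\le j\le Z_i(n)$. -/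

import Mathlib

open MeasureTheory ProbabilityTheory Filter Topology
open scoped ENNReal

noncomputable section

namespace TwoType

/-! ### Extreme value laws

The shape parameter `θ` is a nonzero extended real number; `θ = ⊤` and `θ = ⊥` both
stand for the limiting (Gumbel) case `θ → ±∞`. -/

/-- The exponent `h(x, θ) = (1 + x / θ) ^ (-θ)`, with `h(x, ±∞) = exp (-x)`.
It takes values in `[0, ∞]`: where `1 + x / θ ≤ 0`, it is `∞` for `θ > 0` and `0` for `θ < 0`,
so that `exp (-h)` is a distribution function on the whole real line. -/
def evExponent (x : ℝ) (θ : EReal) : ℝ≥0∞ :=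
  if θ = ⊤ ∨ θ = ⊥ then ENNReal.ofReal (Real.exp (-x))
  else ENNReal.ofReal (1 + x / θ.toReal) ^ (-θ.toReal)

/-- The extreme value distribution function `H(x, θ) = exp (-h(x, θ))`, where `exp (-∞) = 0`. -/
def evCDF (x : ℝ) (θ : EReal) : ℝ :=
  if evExponent x θ = ∞ then 0 else Real.exp (-(evExponent x θ).toReal)

/-- `a` and `b` are norming functions that attract the distribution function `F` to `H(·, θ)`:
`F(a(t) x + b(t)) ^ t → H(x, θ)` as `t → ∞`, for every real `x`
(as `H(·, θ)` is continuous, weak convergence is convergence at every point).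
The argument `t` is real because the norming is used at arguments that are not integers;
norming sequences are the case `a(t) = a_⌊t⌋`, `b(t) = b_⌊t⌋`, see
`Attracts.of_sequences`. -/
structure Attracts (F : ℝ → ℝ) (θ : EReal) (a b : ℝ → ℝ) : Prop where
  pos : ∀ᶠ t in atTop, 0 < a t
  tendsto : ∀ x : ℝ, Tendsto (fun t : ℝ => F (a t * x + b t) ^ t) atTop (𝓝 (evCDF x θ))

/-- Norming sequences give norming functions. -/
theorem Attracts.of_sequences {F : ℝ → ℝ} (hF : ∀ x, 0 ≤ F x) {θ : EReal} {a b : ℕ → ℝ}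
    (ha : ∀ᶠ n in atTop, 0 < a n)
    (h : ∀ x : ℝ, Tendsto (fun n : ℕ => F (a n * x + b n) ^ n) atTop (𝓝 (evCDF x θ))) :
    Attracts F θ (fun t => a ⌊t⌋₊) (fun t => b ⌊t⌋₊) where
  pos := (tendsto_nat_floor_atTop (α := ℝ)).eventually ha
  tendsto x := by
    have h1 := (h x).comp (tendsto_nat_floor_atTop (α := ℝ))
    have h2 : Tendsto (fun t : ℝ => t / (⌊t⌋₊ : ℝ)) atTop (𝓝 1) := by
      simpa using (tendsto_nat_floor_div_atTop (R := ℝ)).inv₀ one_ne_zero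
    have h3 := h1.rpow h2 (Or.inr one_pos)
    rw [Real.rpow_one] at h3
    refine h3.congr' ?_
    filter_upwards [eventually_ge_atTop (1 : ℝ)] with t ht
    have h4 : (⌊t⌋₊ : ℝ) ≠ 0 := by
      have := (Nat.one_le_floor_iff t).2 ht
      positivity
    simp only [Function.comp]
    rw [← Real.rpow_natCast, ← Real.rpow_mul (hF _), mul_div_cancel₀ _ h4]

/-- The right endpoint `sup {x | F x < 1}` of a distribution function, possibly `∞`. -/
def rightEndpoint (F : ℝ → ℝ) : EReal :=
  sSup ((fun x : ℝ => (x : EReal)) '' {x | F x < 1})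

/-- `F₁` and `F₂` are tail equivalent with ratio `A`: they have the same right endpoint `x₀`, and
`(1 - F₁ x) / (1 - F₂ x) → A` as `x ↑ x₀`. -/
structure TailEquivalent (F₁ F₂ : ℝ → ℝ) (A : ℝ) : Prop where
  pos : 0 < A
  endpoint : rightEndpoint F₁ = rightEndpoint F₂
  tendsto : Tendsto (fun x : ℝ => (1 - F₁ x) / (1 - F₂ x))
    (comap (fun x : ℝ => (x : EReal)) (𝓝[<] rightEndpoint F₁)) (𝓝 A)

/-- The scale constant `c`: `A ^ (1 / θ)` for finite `θ`, and `1` for `θ = ±∞`. -/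
def tailScale (A : ℝ) (θ : EReal) : ℝ :=
  if θ = ⊤ ∨ θ = ⊥ then 1 else A ^ (1 / θ.toReal)

/-- The shift constant `d`: `θ (A ^ (1 / θ) - 1)` for finite `θ`, and `log A` for `θ = ±∞`. -/
def tailShift (A : ℝ) (θ : EReal) : ℝ :=
  if θ = ⊤ ∨ θ = ⊥ then Real.log A else θ.toReal * (A ^ (1 / θ.toReal) - 1)

/-- The limit `1 / (1 + h(x, θ) + r h(c x + d, θ))`, read as `0` where `h` is infinite. -/
def limitCDF (A r : ℝ) (θ : EReal) (x : ℝ) : ℝ :=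
  (1 / (1 + evExponent x θ
    + ENNReal.ofReal r * evExponent (tailScale A θ * x + tailShift A θ) θ)).toReal

/-! ### Two-type branching processes

The two types are `0` and `1` in `Fin 2`; `p i` is the law of the offspring vector of an
individual of type `i`. -/

/-- The mean matrix: entry `(i, k)` is the mean number of type `k` children of a type `i` parent. -/
def meanMatrix (p : Fin 2 → Measure (Fin 2 → ℕ)) : Matrix (Fin 2) (Fin 2) ℝ :=
  Matrix.of fun i k => ∫ x, (x k : ℝ) ∂(p i)

/-- The constant `B`, half of the offspring variance
`2 B = ∑ i j k, v i * E [X_j (X_k - δ_jk)] * u j * u k`, where `X` has law `p i`. -/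
def halfVariance (p : Fin 2 → Measure (Fin 2 → ℕ)) (u v : Fin 2 → ℝ) : ℝ :=
  (1 / 2) * ∑ i, ∑ j, ∑ k,
    v i * (∫ x, (x j : ℝ) * ((x k : ℝ) - if j = k then 1 else 0) ∂(p i)) * u j * u k

/-- Offspring laws of a critical, positively regular, nonsingular two-type process with finite
variance, with right and left eigenvectors `u` and `v` of the mean matrix for its maximal
eigenvalue `1`. -/
structure IsCritical (p : Fin 2 → Measure (Fin 2 → ℕ)) (u v : Fin 2 → ℝ) : Prop where
  /-- finite second moments -/
  memLp : ∀ i k, MemLp (fun x : Fin 2 → ℕ => (x k : ℝ)) 2 (p i)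
  /-- positive regularity: some power of the mean matrix has only positive entries -/
  posRegular : (meanMatrix p).IsPrimitive
  /-- nonsingularity: it is not the case that every individual has exactly one child a.s. -/
  nonsingular : ¬ ∀ i, ∀ᵐ x ∂(p i), ∑ k, x k = 1
  /-- criticality: the maximal eigenvalue of the mean matrix is one -/
  maxEigenvalue : IsGreatest (spectrum ℝ (meanMatrix p)) 1
  right : (meanMatrix p).mulVec u = u
  left : Matrix.vecMul v (meanMatrix p) = v
  dot : u ⬝ᵥ v = 1
  sum : ∑ i, u i = 1

/-- The generation sizes. `X i n j ω k` is the number of children of type `k`, living in generation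
`n`, of the `j`-th individual of type `i` of generation `n - 1` (individuals are numbered
from `0`). -/
def size {Ω : Type*} (Z₀ : Ω → Fin 2 → ℕ) (X : Fin 2 → ℕ → ℕ → Ω → Fin 2 → ℕ) :
    ℕ → Ω → Fin 2 → ℕ
  | 0, ω => Z₀ ω
  | n + 1, ω => fun k => ∑ i, ∑ j ∈ Finset.range (size Z₀ X n ω i), X i (n + 1) j ω k

/-- The maximum of the scores `ζ i n j`, `j < N i`, `i = 0, 1`. The set is finite, and it is
nonempty unless `N = 0`. -/
def maxScore {Ω : Type*} (ζ : Fin 2 → ℕ → ℕ → Ω → ℝ) (n : ℕ) (N : Fin 2 → ℕ) (ω : Ω) : ℝ :=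
  sSup {y | ∃ i, ∃ j < N i, y = ζ i n j ω}

/-- The random variables that drive a two-type branching process with scores: an initial vector
`Z₀ ≠ 0` with finite mean, offspring vectors `X i n j` with law `p i`, and scores `ζ i n j` with
law `S i`, all of them independent. -/
structure IsScoredProcess {Ω : Type*} [MeasurableSpace Ω] (μ : Measure Ω)
    (p : Fin 2 → Measure (Fin 2 → ℕ)) (S : Fin 2 → Measure ℝ)
    (Z₀ : Ω → Fin 2 → ℕ) (X : Fin 2 → ℕ → ℕ → Ω → Fin 2 → ℕ)
    (ζ : Fin 2 → ℕ → ℕ → Ω → ℝ) : Prop where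
  measurable_init : Measurable Z₀
  measurable_offspring : ∀ i n j, Measurable (X i n j)
  measurable_score : ∀ i n j, Measurable (ζ i n j)
  init_ne_zero : ∀ᵐ ω ∂μ, Z₀ ω ≠ 0
  init_integrable : ∀ i, Integrable (fun ω => (Z₀ ω i : ℝ)) μ
  law_offspring : ∀ i n j, HasLaw (X i n j) (p i) μ
  law_score : ∀ i n j, HasLaw (ζ i n j) (S i) μ
  /-- the offspring vectors are independent -/
  indep_offspring : iIndepFun (fun (q : Fin 2 × ℕ × ℕ) ω => X q.1 q.2.1 q.2.2 ω) μ
  /-- the initial vector is independent of all the offspring vectors -/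
  indep_init : IndepFun Z₀ (fun ω (q : Fin 2 × ℕ × ℕ) => X q.1 q.2.1 q.2.2 ω) μ
  /-- the scores are independent -/
  indep_score : iIndepFun (fun (q : Fin 2 × ℕ × ℕ) ω => ζ q.1 q.2.1 q.2.2 ω) μ
  /-- the scores are independent of the branching process -/
  indep_process : IndepFun
    (fun ω => (Z₀ ω, fun (q : Fin 2 × ℕ × ℕ) => X q.1 q.2.1 q.2.2 ω))
    (fun ω (q : Fin 2 × ℕ × ℕ) => ζ q.1 q.2.1 q.2.2 ω) μ

end TwoType

end

namespace TwoType

/-- The probability that at least one of `x` individuals is marked, when those of type `k` are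
marked independently with probability `q k`. -/
def escape (x : Fin 2 → ℕ) (q : Fin 2 → ℝ) : ℝ := 1 - ∏ k, (1 - q k) ^ x k

theorem vec_induction {P : (Fin 2 → ℕ) → Prop} (h0 : P 0)
    (hs : ∀ x k, P x → P (x + Pi.single k 1)) (x : Fin 2 → ℕ) : P x := by
  induction hn : x 0 + x 1 generalizing x with
  | zero =>
    have : x = 0 := by ext k; fin_cases k <;> simp <;> omega
    rwa [this]
  | succ n ih =>
    obtain ⟨k, hk⟩ : ∃ k, x k ≠ 0 := by
      by_contra! h
      have := h 0; have := h 1; omega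
    have hx : x = (x - Pi.single k 1) + Pi.single k 1 := by
      ext l; fin_cases k <;> fin_cases l <;> simp at hk ⊢ <;> omega
    rw [hx]
    refine hs _ _ (ih _ ?_)
    fin_cases k <;> simp at hk ⊢ <;> omega

theorem escape_zero_left (q : Fin 2 → ℝ) : escape 0 q = 0 := by simp [escape]

theorem escape_zero_right (x : Fin 2 → ℕ) : escape x 0 = 0 := by simp [escape]

theorem escape_add_single (x : Fin 2 → ℕ) (k : Fin 2) (q : Fin 2 → ℝ) :
    escape (x + Pi.single k 1) q = escape x q + q k * (1 - escape x q) := by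
  fin_cases k <;> simp [escape, Fin.prod_univ_two] <;> ring

theorem sum_add_single (x : Fin 2 → ℕ) (k : Fin 2) (q : Fin 2 → ℝ) :
    ∑ l, ((x + Pi.single k 1 : Fin 2 → ℕ) l : ℝ) * q l = ∑ l, (x l : ℝ) * q l + q k := by
  fin_cases k <;> simp [Fin.sum_univ_two] <;> ring

theorem escape_le_one {x : Fin 2 → ℕ} {q : Fin 2 → ℝ} (h1 : q ≤ 1) : escape x q ≤ 1 := by
  have : 0 ≤ ∏ k, (1 - q k) ^ x k :=
    Finset.prod_nonneg fun k _ => pow_nonneg (sub_nonneg.2 (h1 k)) _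
  unfold escape; linarith

theorem escape_mono {x : Fin 2 → ℕ} {q r : Fin 2 → ℝ} (h : q ≤ r) (h1 : r ≤ 1) :
    escape x q ≤ escape x r := by
  have : ∏ k, (1 - r k) ^ x k ≤ ∏ k, (1 - q k) ^ x k :=
    Finset.prod_le_prod (fun k _ => pow_nonneg (sub_nonneg.2 (h1 k)) _) fun k _ =>
      pow_le_pow_left₀ (sub_nonneg.2 (h1 k)) (sub_le_sub_left (h k) _) _
  unfold escape; linarith

theorem escape_nonneg {x : Fin 2 → ℕ} {q : Fin 2 → ℝ} (h0 : 0 ≤ q) (h1 : q ≤ 1) :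
    0 ≤ escape x q := by
  simpa [escape_zero_right] using escape_mono (x := x) h0 h1

theorem sum_mul_nonneg {x : Fin 2 → ℕ} {q : Fin 2 → ℝ} (h0 : 0 ≤ q) :
    0 ≤ ∑ k, (x k : ℝ) * q k :=
  Finset.sum_nonneg fun k _ => mul_nonneg (Nat.cast_nonneg _) (h0 k)

theorem escape_le_sum {x : Fin 2 → ℕ} {q : Fin 2 → ℝ} (h0 : 0 ≤ q) (h1 : q ≤ 1) :
    escape x q ≤ ∑ k, (x k : ℝ) * q k := by
  induction x using vec_induction with
  | h0 => simp [escape]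
  | hs x k ih =>
    rw [escape_add_single, sum_add_single]
    nlinarith [mul_nonneg (h0 k) (escape_nonneg (x := x) h0 h1)]

theorem sum_sub_escape_le {x : Fin 2 → ℕ} {q : Fin 2 → ℝ} (h0 : 0 ≤ q) (h1 : q ≤ 1) :
    ∑ k, (x k : ℝ) * q k - escape x q ≤ (∑ k, (x k : ℝ) * q k) ^ 2 := by
  induction x using vec_induction with
  | h0 => simp [escape]
  | hs x k ih =>
    rw [escape_add_single, sum_add_single]
    have h2 := mul_le_mul_of_nonneg_left (escape_le_sum (x := x) h0 h1) (h0 k)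
    have h3 := mul_nonneg (h0 k) (sum_mul_nonneg (x := x) h0)
    nlinarith [sq_nonneg (q k)]

theorem mul_le_sum_sub_escape {x : Fin 2 → ℕ} {q : Fin 2 → ℝ} (h0 : 0 ≤ q) (h1 : q ≤ 1)
    {j k : Fin 2} (hx : Pi.single j 1 + Pi.single k 1 ≤ x) :
    q j * q k ≤ ∑ l, (x l : ℝ) * q l - escape x q := by
  obtain ⟨y, rfl⟩ := exists_add_of_le hx
  rw [add_comm]
  clear hx
  induction y using vec_induction with
  | h0 =>
    have e := escape_add_single (Pi.single j 1) k q
    have e' := escape_add_single 0 j q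
    have f := sum_add_single (Pi.single j 1) k q
    have f' := sum_add_single 0 j q
    simp only [zero_add, escape_zero_left, Pi.zero_apply, Nat.cast_zero, zero_mul,
      Finset.sum_const_zero] at e' f' ⊢
    rw [e, f, e', f']
    linarith
  | hs x l ih =>
    rw [add_right_comm, escape_add_single, sum_add_single]
    nlinarith [mul_nonneg (h0 l) (escape_nonneg (x := x + (Pi.single j 1 + Pi.single k 1)) h0 h1)]

/-- First order expansion of `escape` at the origin. -/
theorem tendsto_escape_div {α : Type*} {l : Filter α} {y : α → ℝ} {r : α → Fin 2 → ℝ}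
    {u : Fin 2 → ℝ} (hy : Tendsto y l (𝓝 0)) (hy0 : ∀ᶠ a in l, 0 < y a)
    (hr : Tendsto r l (𝓝 u)) (h0 : ∀ᶠ a in l, 0 ≤ r a) (h1 : ∀ᶠ a in l, y a • r a ≤ 1)
    (x : Fin 2 → ℕ) :
    Tendsto (fun a => escape x (y a • r a) / y a) l (𝓝 (∑ k, (x k : ℝ) * u k)) := by
  have hs : Tendsto (fun a => ∑ k, (x k : ℝ) * r a k) l (𝓝 (∑ k, (x k : ℝ) * u k)) :=
    tendsto_finsetSum _ fun k _ => (tendsto_pi_nhds.1 hr k).const_mul _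
  have hl := hs.sub (hy.mul (hs.pow 2))
  rw [zero_mul, sub_zero] at hl
  have key : ∀ a, ∑ k, (x k : ℝ) * (y a • r a) k = y a * ∑ k, (x k : ℝ) * r a k := fun a => by
    simp only [Pi.smul_apply, smul_eq_mul, Finset.mul_sum]
    exact Finset.sum_congr rfl fun _ _ => by ring
  refine tendsto_of_tendsto_of_tendsto_of_le_of_le' hl hs ?_ ?_
  · filter_upwards [hy0, h0, h1] with a ha h0 h1
    have := sum_sub_escape_le (x := x) (smul_nonneg ha.le h0) h1
    rw [key] at this
    rw [le_div_iff₀ ha]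
    nlinarith
  · filter_upwards [hy0, h0, h1] with a ha h0 h1
    have := escape_le_sum (x := x) (smul_nonneg ha.le h0) h1
    rw [key] at this
    rw [div_le_iff₀ ha]
    nlinarith

/-- Second order expansion of `escape` at the origin. -/
theorem tendsto_sum_sub_escape_div {α : Type*} {l : Filter α} {y : α → ℝ} {r : α → Fin 2 → ℝ}
    {u : Fin 2 → ℝ} (hy : Tendsto y l (𝓝 0)) (hy0 : ∀ᶠ a in l, 0 < y a)
    (hr : Tendsto r l (𝓝 u)) (h0 : ∀ᶠ a in l, 0 ≤ r a) (h1 : ∀ᶠ a in l, y a • r a ≤ 1)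
    (x : Fin 2 → ℕ) :
    Tendsto (fun a => (∑ k, (x k : ℝ) * (y a • r a) k - escape x (y a • r a)) / y a ^ 2) l
      (𝓝 (((∑ k, (x k : ℝ) * u k) ^ 2 - ∑ k, (x k : ℝ) * u k ^ 2) / 2)) := by
  induction x using vec_induction with
  | h0 => simpa [escape] using tendsto_const_nhds
  | hs x k ih =>
    have h2 := ih.add ((tendsto_pi_nhds.1 hr k).mul (tendsto_escape_div hy hy0 hr h0 h1 x))
    have e := sum_add_single x k (fun k => u k ^ 2)

    rw [sum_add_single, e]
    refine (h2.congr' ?_).trans_eq (by congr 1; ring)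
    filter_upwards [hy0] with a ha
    rw [escape_add_single, sum_add_single]
    have e' : (y a • r a) k = y a * r a k := rfl
    rw [e']
    field_simp
    ring

end TwoType

namespace TwoType

/-- The probability that a random vector of individuals with law `m` contains a marked one, when
individuals of type `k` are marked with probability `q k`. -/
noncomputable def escapeMean (m : Measure (Fin 2 → ℕ)) (q : Fin 2 → ℝ) : ℝ := ∫ x, escape x q ∂m

variable {m : Measure (Fin 2 → ℕ)} {q r : Fin 2 → ℝ}

theorem aestronglyMeasurable_vec {E : Type*} [TopologicalSpace E]
    [TopologicalSpace.PseudoMetrizableSpace E] [SecondCountableTopology E]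
    [MeasurableSpace E] [OpensMeasurableSpace E] (f : (Fin 2 → ℕ) → E) :
    AEStronglyMeasurable f m :=
  (Measurable.of_discrete (f := f)).aestronglyMeasurable

theorem integrable_escape [IsFiniteMeasure m] (h0 : 0 ≤ q) (h1 : q ≤ 1) :
    Integrable (fun x => escape x q) m :=
  (integrable_const (1 : ℝ)).mono' (aestronglyMeasurable_vec _) <| .of_forall fun x => by
    rw [Real.norm_eq_abs, abs_of_nonneg (escape_nonneg h0 h1)]
    exact escape_le_one h1

theorem escapeMean_mono [IsFiniteMeasure m] (h0 : 0 ≤ q) (h : q ≤ r) (h1 : r ≤ 1) :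
    escapeMean m q ≤ escapeMean m r :=
  integral_mono (integrable_escape h0 (h.trans h1)) (integrable_escape (h0.trans h) h1)
    fun _ => escape_mono h h1

theorem escapeMean_nonneg (h0 : 0 ≤ q) (h1 : q ≤ 1) : 0 ≤ escapeMean m q :=
  integral_nonneg fun _ => escape_nonneg h0 h1

theorem escapeMean_le_one [IsProbabilityMeasure m] (h0 : 0 ≤ q) (h1 : q ≤ 1) :
    escapeMean m q ≤ 1 := by
  simpa [escapeMean] using integral_mono (integrable_escape (m := m) h0 h1) (integrable_const 1)
    fun _ => escape_le_one h1

theorem integrable_sum_mul (hm : ∀ k, Integrable (fun x : Fin 2 → ℕ => (x k : ℝ)) m)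
    (q : Fin 2 → ℝ) : Integrable (fun x : Fin 2 → ℕ => ∑ k, (x k : ℝ) * q k) m :=
  integrable_finsetSum _ fun k _ => (hm k).mul_const _

theorem integral_sum_mul (hm : ∀ k, Integrable (fun x : Fin 2 → ℕ => (x k : ℝ)) m)
    (q : Fin 2 → ℝ) :
    ∫ x, ∑ k, (x k : ℝ) * q k ∂m = ∑ k, (∫ x, (x k : ℝ) ∂m) * q k := by
  rw [integral_finsetSum _ fun k _ => (hm k).mul_const _]
  simp only [integral_mul_const]

theorem sum_sub_escapeMean [IsFiniteMeasure m]
    (hm : ∀ k, Integrable (fun x : Fin 2 → ℕ => (x k : ℝ)) m) (h0 : 0 ≤ q) (h1 : q ≤ 1) :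
    ∑ k, (∫ x, (x k : ℝ) ∂m) * q k - escapeMean m q
      = ∫ x, (∑ k, (x k : ℝ) * q k - escape x q) ∂m := by
  rw [integral_sub (integrable_sum_mul hm q) (integrable_escape h0 h1), integral_sum_mul hm,
    escapeMean]

theorem escapeMean_le [IsFiniteMeasure m]
    (hm : ∀ k, Integrable (fun x : Fin 2 → ℕ => (x k : ℝ)) m) (h0 : 0 ≤ q) (h1 : q ≤ 1) :
    escapeMean m q ≤ ∑ k, (∫ x, (x k : ℝ) ∂m) * q k := by
  rw [← sub_nonneg, sum_sub_escapeMean hm h0 h1]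
  exact integral_nonneg fun x => sub_nonneg.2 (escape_le_sum h0 h1)

theorem mul_le_sum_sub_escapeMean [IsFiniteMeasure m]
    (hm : ∀ k, Integrable (fun x : Fin 2 → ℕ => (x k : ℝ)) m) (h0 : 0 ≤ q) (h1 : q ≤ 1)
    (j k : Fin 2) :
    m.real {x | Pi.single j 1 + Pi.single k 1 ≤ x} * (q j * q k)
      ≤ ∑ k, (∫ x, (x k : ℝ) ∂m) * q k - escapeMean m q := by
  rw [sum_sub_escapeMean hm h0 h1, ← smul_eq_mul, ← setIntegral_const,
    ← integral_indicator (.of_discrete)]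
  refine integral_mono ((integrable_const _).indicator .of_discrete)
    ((integrable_sum_mul hm q).sub (integrable_escape h0 h1)) fun x => ?_
  by_cases hx : Pi.single j 1 + Pi.single k 1 ≤ x
  · simpa [Set.indicator, hx] using mul_le_sum_sub_escape h0 h1 hx
  · simpa [Set.indicator, hx] using escape_le_sum h0 h1

theorem sum_mul_le {x : Fin 2 → ℕ} {c : ℝ} (hc : ∀ k, q k ≤ c) :
    ∑ k, (x k : ℝ) * q k ≤ (∑ k, (x k : ℝ)) * c := by
  rw [Finset.sum_mul]
  exact Finset.sum_le_sum fun k _ => mul_le_mul_of_nonneg_left (hc k) (Nat.cast_nonneg _)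

theorem integrable_sum_sq (hm : ∀ k, MemLp (fun x : Fin 2 → ℕ => (x k : ℝ)) 2 m) :
    Integrable (fun x : Fin 2 → ℕ => (∑ k, (x k : ℝ)) ^ 2) m :=
  (memLp_finsetSum _ fun k _ => hm k).integrable_sq

theorem sum_sub_escapeMean_le [IsFiniteMeasure m]
    (hm : ∀ k, MemLp (fun x : Fin 2 → ℕ => (x k : ℝ)) 2 m) (h0 : 0 ≤ q) (h1 : q ≤ 1)
    {c : ℝ} (hc : ∀ k, q k ≤ c) :
    ∑ k, (∫ x, (x k : ℝ) ∂m) * q k - escapeMean m q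
      ≤ (∫ x, (∑ k, (x k : ℝ)) ^ 2 ∂m) * c ^ 2 := by
  have hi := fun k => (hm k).integrable one_le_two
  rw [sum_sub_escapeMean hi h0 h1, ← integral_mul_const]
  refine integral_mono ((integrable_sum_mul hi q).sub (integrable_escape h0 h1))
    ((integrable_sum_sq hm).mul_const _) fun x => (sum_sub_escape_le h0 h1).trans ?_
  simp only [← mul_pow]
  exact pow_le_pow_left₀ (sum_mul_nonneg h0) (sum_mul_le hc) 2

section expansion

variable {l : Filter ℕ} {y : ℕ → ℝ} {r : ℕ → Fin 2 → ℝ} {u : Fin 2 → ℝ}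

theorem eventually_le_const (hr : Tendsto r l (𝓝 u)) : ∃ c : ℝ, ∀ᶠ a in l, ∀ k, r a k ≤ c := by
  refine ⟨max (u 0) (u 1) + 1, eventually_all.2 fun k => ?_⟩
  refine ((tendsto_pi_nhds.1 hr k).eventually_lt_const (u := max (u 0) (u 1) + 1) ?_).mono
    fun _ => le_of_lt
  fin_cases k
  · exact (le_max_left _ _).trans_lt (lt_add_one _)
  · exact (le_max_right _ _).trans_lt (lt_add_one _)

/-- First order expansion of `escapeMean` at the origin. -/
theorem tendsto_escapeMean_div [l.IsCountablyGenerated]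
    (hm : ∀ k, Integrable (fun x : Fin 2 → ℕ => (x k : ℝ)) m)
    (hy : Tendsto y l (𝓝 0)) (hy0 : ∀ᶠ a in l, 0 < y a)
    (hr : Tendsto r l (𝓝 u)) (h0 : ∀ᶠ a in l, 0 ≤ r a) (h1 : ∀ᶠ a in l, y a • r a ≤ 1) :
    Tendsto (fun a => escapeMean m (y a • r a) / y a) l
      (𝓝 (∑ k, (∫ x, (x k : ℝ) ∂m) * u k)) := by
  obtain ⟨c, hc⟩ := eventually_le_const hr
  rw [← integral_sum_mul hm]
  simp only [escapeMean, ← integral_div]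
  refine tendsto_integral_filter_of_dominated_convergence
    (fun x => (∑ k, (x k : ℝ)) * c) (.of_forall fun _ => aestronglyMeasurable_vec _) ?_
    ((integrable_finsetSum _ fun k _ => hm k).mul_const c)
    (.of_forall fun x => tendsto_escape_div hy hy0 hr h0 h1 x)
  filter_upwards [hc, hy0, h0, h1] with a hc hy0 h0 h1
  refine .of_forall fun x => ?_
  have h2 := smul_nonneg hy0.le h0
  rw [Real.norm_eq_abs, abs_of_nonneg (div_nonneg (escape_nonneg h2 h1) hy0.le), div_le_iff₀ hy0]
  refine (escape_le_sum h2 h1).trans ((sum_mul_le (c := c * y a) fun k => ?_).trans_eq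
    (mul_assoc _ _ _).symm)
  rw [mul_comm c]
  exact mul_le_mul_of_nonneg_left (hc k) hy0.le

/-- Second order expansion of `escapeMean` at the origin. -/
theorem tendsto_sum_sub_escapeMean_div [IsFiniteMeasure m] [l.IsCountablyGenerated]
    (hm : ∀ k, MemLp (fun x : Fin 2 → ℕ => (x k : ℝ)) 2 m)
    (hy : Tendsto y l (𝓝 0)) (hy0 : ∀ᶠ a in l, 0 < y a)
    (hr : Tendsto r l (𝓝 u)) (h0 : ∀ᶠ a in l, 0 ≤ r a) (h1 : ∀ᶠ a in l, y a • r a ≤ 1) :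
    Tendsto (fun a => (∑ k, (∫ x, (x k : ℝ) ∂m) * (y a • r a) k - escapeMean m (y a • r a))
        / y a ^ 2) l
      (𝓝 (∫ x, ((∑ k, (x k : ℝ) * u k) ^ 2 - ∑ k, (x k : ℝ) * u k ^ 2) / 2 ∂m)) := by
  obtain ⟨c, hc⟩ := eventually_le_const hr
  have hi := fun k => (hm k).integrable one_le_two
  have : Tendsto (fun a => ∫ x, (∑ k, (x k : ℝ) * (y a • r a) k - escape x (y a • r a))
      / y a ^ 2 ∂m) l
      (𝓝 (∫ x, ((∑ k, (x k : ℝ) * u k) ^ 2 - ∑ k, (x k : ℝ) * u k ^ 2) / 2 ∂m)) := by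
    refine tendsto_integral_filter_of_dominated_convergence
      (fun x => (∑ k, (x k : ℝ)) ^ 2 * c ^ 2) (.of_forall fun _ => aestronglyMeasurable_vec _) ?_
      ((integrable_sum_sq hm).mul_const _)
      (.of_forall fun x => tendsto_sum_sub_escape_div hy hy0 hr h0 h1 x)
    filter_upwards [hc, hy0, h0, h1] with a hc hy0 h0 h1
    refine .of_forall fun x => ?_
    have h2 := smul_nonneg hy0.le h0
    rw [Real.norm_eq_abs, abs_of_nonneg (div_nonneg (sub_nonneg.2 (escape_le_sum h2 h1))
      (sq_nonneg _)), div_le_iff₀ (by positivity)]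
    refine (sum_sub_escape_le h2 h1).trans ?_
    rw [← mul_pow, ← mul_pow, mul_assoc]
    refine pow_le_pow_left₀ (sum_mul_nonneg h2) (sum_mul_le (c := c * y a) fun k => ?_) 2
    rw [mul_comm c]
    exact mul_le_mul_of_nonneg_left (hc k) hy0.le
  refine this.congr' ?_
  filter_upwards [hy0, h0, h1] with a hy0 h0 h1
  rw [integral_div, sum_sub_escapeMean hi (smul_nonneg hy0.le h0) h1]

end expansion

/-- The generating functions of the offspring laws, in terms of complementary probabilities. -/
noncomputable def genMap (p : Fin 2 → Measure (Fin 2 → ℕ)) (q : Fin 2 → ℝ) : Fin 2 → ℝ :=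
  fun i => escapeMean (p i) q

section genMap

variable {p : Fin 2 → Measure (Fin 2 → ℕ)} [∀ i, IsProbabilityMeasure (p i)] {q r : Fin 2 → ℝ}

theorem genMap_mono (h0 : 0 ≤ q) (h : q ≤ r) (h1 : r ≤ 1) : genMap p q ≤ genMap p r :=
  fun _ => escapeMean_mono h0 h h1

theorem iterate_genMap_mem (h0 : 0 ≤ q) (h1 : q ≤ 1) (n : ℕ) :
    0 ≤ (genMap p)^[n] q ∧ (genMap p)^[n] q ≤ 1 := by
  induction n with
  | zero => exact ⟨h0, h1⟩
  | succ n ih =>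
    rw [Function.iterate_succ_apply']
    exact ⟨fun _ => escapeMean_nonneg ih.1 ih.2, fun _ => escapeMean_le_one ih.1 ih.2⟩

theorem iterate_genMap_mono (h0 : 0 ≤ q) (h : q ≤ r) (h1 : r ≤ 1) (n : ℕ) :
    (genMap p)^[n] q ≤ (genMap p)^[n] r := by
  induction n with
  | zero => exact h
  | succ n ih =>
    simp only [Function.iterate_succ_apply']
    exact genMap_mono (iterate_genMap_mem h0 (h.trans h1) n).1 ih
      (iterate_genMap_mem (h0.trans h) h1 n).2

end genMap

end TwoType

namespace TwoType

section Perron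

variable {M : Matrix (Fin 2) (Fin 2) ℝ}

theorem isPrimitive_offDiag_pos (hM : M.IsPrimitive) : 0 < M 0 1 ∧ 0 < M 1 0 := by
  obtain ⟨k, -, hk⟩ := hM.exists_pos_pow
  constructor
  · refine (hM.nonneg 0 1).lt_of_ne' fun h => ?_
    have : ∀ k, (M ^ k) 0 1 = 0 := fun k => by
      induction k with
      | zero => simp
      | succ k ih => rw [pow_succ, Matrix.mul_apply, Fin.sum_univ_two, ih, h]; simp
    exact (hk 0 1).ne' (this k)
  · refine (hM.nonneg 1 0).lt_of_ne' fun h => ?_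
    have : ∀ k, (M ^ k) 1 0 = 0 := fun k => by
      induction k with
      | zero => simp
      | succ k ih => rw [pow_succ, Matrix.mul_apply, Fin.sum_univ_two, ih, h]; simp
    exact (hk 1 0).ne' (this k)

theorem isPrimitive_trace_pos (hM : M.IsPrimitive) : 0 < M 0 0 + M 1 1 := by
  obtain ⟨k, -, hk⟩ := hM.exists_pos_pow
  refine (add_nonneg (hM.nonneg 0 0) (hM.nonneg 1 1)).lt_of_ne' fun h => ?_
  have h0 : M 0 0 = 0 := by linarith [hM.nonneg 0 0, hM.nonneg 1 1]
  have h1 : M 1 1 = 0 := by linarith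
  have : ∀ k, (M ^ k) 0 0 * (M ^ k) 0 1 = 0 := fun k => by
    induction k with
    | zero => simp
    | succ k ih =>
      rw [pow_succ, Matrix.mul_apply, Matrix.mul_apply, Fin.sum_univ_two, Fin.sum_univ_two, h0, h1]
      linear_combination M 1 0 * M 0 1 * ih
  exact (mul_pos (hk 0 0) (hk 0 1)).ne' (this k)

theorem mem_spectrum_iff_fin_two {r : ℝ} :
    r ∈ spectrum ℝ M ↔ (r - M 0 0) * (r - M 1 1) = M 0 1 * M 1 0 := by
  rw [Matrix.mem_spectrum_iff_isRoot_charpoly, Matrix.charpoly_fin_two, Polynomial.IsRoot.def]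
  simp only [Polynomial.eval_add, Polynomial.eval_sub, Polynomial.eval_mul, Polynomial.eval_pow,
    Polynomial.eval_X, Polynomial.eval_C, Matrix.trace_fin_two, Matrix.det_fin_two]
  constructor <;> intro h <;> linarith

theorem diag_lt_one (hM : M.IsPrimitive) (h1 : IsGreatest (spectrum ℝ M) 1) :
    M 0 0 < 1 ∧ M 1 1 < 1 := by
  have hd := mem_spectrum_iff_fin_two.1 h1.1
  have h2 : M 0 0 + M 1 1 - 1 ∈ spectrum ℝ M := mem_spectrum_iff_fin_two.2 (by linarith)
  have h3 := h1.2 h2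
  have hp := isPrimitive_offDiag_pos hM
  have h4 := mul_pos hp.1 hp.2
  constructor <;> nlinarith

end Perron

variable {p : Fin 2 → Measure (Fin 2 → ℕ)} {u v : Fin 2 → ℝ}

/-- A left eigenvector of the mean matrix that annihilates the right eigenvector `u`. -/
def transverse (u q : Fin 2 → ℝ) : ℝ := u 1 * q 0 - u 0 * q 1

/-- The second eigenvalue of the mean matrix. -/
noncomputable def secondEigenvalue (p : Fin 2 → Measure (Fin 2 → ℕ)) : ℝ :=
  meanMatrix p 0 0 + meanMatrix p 1 1 - 1

theorem mulVec_apply_two (M : Matrix (Fin 2) (Fin 2) ℝ) (q : Fin 2 → ℝ) (i : Fin 2) :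
    M.mulVec q i = M i 0 * q 0 + M i 1 * q 1 := by
  simp [Matrix.mulVec, dotProduct, Fin.sum_univ_two]

namespace IsCritical

variable (h : IsCritical p u v)
include h

theorem right_pos (i : Fin 2) : 0 < u i := by
  have h1 := congrFun h.right 0
  have h2 := congrFun h.right 1
  rw [mulVec_apply_two] at h1 h2
  have h3 := h.sum
  rw [Fin.sum_univ_two] at h3
  obtain ⟨hb, hc⟩ := isPrimitive_offDiag_pos h.posRegular
  obtain ⟨ha, hd⟩ := diag_lt_one h.posRegular h.maxEigenvalue
  have hu : 0 < u 0 ∧ 0 < u 1 := by constructor <;> by_contra! hn <;> nlinarith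
  fin_cases i
  exacts [hu.1, hu.2]

theorem dot_two : u 0 * v 0 + u 1 * v 1 = 1 := by
  simpa [dotProduct, Fin.sum_univ_two] using h.dot

theorem left_eq (i : Fin 2) : v 0 * meanMatrix p 0 i + v 1 * meanMatrix p 1 i = v i := by
  simpa [Matrix.vecMul, dotProduct, Fin.sum_univ_two] using congrFun h.left i

theorem left_pos (i : Fin 2) : 0 < v i := by
  have h1 := h.left_eq 0
  have h2 := h.left_eq 1
  have h3 := h.dot_two
  have hu := h.right_pos 0
  have hu' := h.right_pos 1
  obtain ⟨hb, hc⟩ := isPrimitive_offDiag_pos h.posRegular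
  obtain ⟨ha, hd⟩ := diag_lt_one h.posRegular h.maxEigenvalue
  have hv : 0 < v 0 ∧ 0 < v 1 := by
    constructor <;> by_contra! hn
    · have : v 1 ≤ 0 := by
        by_contra! hn'
        nlinarith [mul_pos hc hn']
      nlinarith
    · have : v 0 ≤ 0 := by
        by_contra! hn'
        nlinarith [mul_pos hb hn']
      nlinarith
  fin_cases i
  exacts [hv.1, hv.2]

theorem dot_mulVec (q : Fin 2 → ℝ) : v ⬝ᵥ (meanMatrix p).mulVec q = v ⬝ᵥ q := by
  rw [Matrix.dotProduct_mulVec, h.left]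

theorem transverse_mulVec (q : Fin 2 → ℝ) :
    transverse u ((meanMatrix p).mulVec q) = secondEigenvalue p * transverse u q := by
  have h1 := congrFun h.right 0
  have h2 := congrFun h.right 1
  rw [mulVec_apply_two] at h1 h2
  simp only [transverse, secondEigenvalue, mulVec_apply_two]
  linear_combination q 1 * h1 - q 0 * h2

theorem abs_secondEigenvalue_lt_one : |secondEigenvalue p| < 1 := by
  obtain ⟨ha, hd⟩ := diag_lt_one h.posRegular h.maxEigenvalue
  have := isPrimitive_trace_pos h.posRegular
  rw [abs_lt]
  unfold secondEigenvalue
  constructor <;> linarith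

/-- The expansion of a vector in the right eigenvectors of the mean matrix. -/
theorem eq_dot_smul_add (q : Fin 2 → ℝ) :
    q = (v ⬝ᵥ q) • u + transverse u q • ![v 1, -v 0] := by
  have h1 := h.dot_two
  ext i
  fin_cases i <;> simp [dotProduct, Fin.sum_univ_two, transverse]
  · linear_combination -q 0 * h1
  · linear_combination -q 1 * h1

theorem dot_pos {q : Fin 2 → ℝ} (hq : ∀ i, 0 < q i) : 0 < v ⬝ᵥ q :=
  Finset.sum_pos (fun i _ => mul_pos (h.left_pos i) (hq i)) Finset.univ_nonempty

theorem dot_nonneg {q : Fin 2 → ℝ} (hq : 0 ≤ q) : 0 ≤ v ⬝ᵥ q :=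
  Finset.sum_nonneg fun i _ => mul_nonneg (h.left_pos i).le (hq i)

variable [∀ i, IsProbabilityMeasure (p i)]

theorem integrable (i k : Fin 2) :
    Integrable (fun x : Fin 2 → ℕ => (x k : ℝ)) (p i) :=
  (h.memLp i k).integrable one_le_two

theorem exists_pair_pos :
    ∃ i j k : Fin 2, 0 < (p i).real {x | Pi.single j 1 + Pi.single k 1 ≤ x} := by
  by_contra! hn
  refine h.nonsingular ?_
  have hle : ∀ i, ∀ᵐ x ∂(p i), ∑ k, x k ≤ 1 := fun i => by
    have h1 : ∀ j k : Fin 2, ∀ᵐ x ∂(p i), ¬ (Pi.single j 1 + Pi.single k 1 ≤ x) := fun j k => by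
      rw [ae_iff]
      simpa [measureReal_def, ENNReal.toReal_eq_zero_iff] using
        le_antisymm (hn i j k) measureReal_nonneg
    filter_upwards [ae_all_iff.2 fun j => ae_all_iff.2 fun k => h1 j k] with x hx
    by_contra! hlt
    rw [Fin.sum_univ_two] at hlt
    by_cases h0 : x 0 = 0
    · exact hx 1 1 fun l => by fin_cases l <;> simp; omega
    · by_cases h1 : x 1 = 0
      · exact hx 0 0 fun l => by fin_cases l <;> simp; omega
      · exact hx 0 1 fun l => by fin_cases l <;> simp <;> omega
  have hint : ∀ i, Integrable (fun x : Fin 2 → ℕ => (1 : ℝ) - ∑ k, (x k : ℝ)) (p i) := fun i =>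
    (integrable_const _).sub (integrable_finsetSum _ fun k _ => h.integrable i k)
  have hval : ∀ i, ∫ x, ((1 : ℝ) - ∑ k, (x k : ℝ)) ∂(p i)
      = 1 - (meanMatrix p i 0 + meanMatrix p i 1) := fun i => by
    rw [integral_sub (integrable_const _) (integrable_finsetSum _ fun k _ => h.integrable i k),
      integral_finsetSum _ fun k _ => h.integrable i k]
    simp [meanMatrix, Fin.sum_univ_two]
  have hnn : ∀ i, 0 ≤ᵐ[p i] fun x => (1 : ℝ) - ∑ k, (x k : ℝ) := fun i => by
    filter_upwards [hle i] with x hx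
    have : ((∑ k, x k : ℕ) : ℝ) ≤ 1 := by exact_mod_cast hx
    push_cast at this
    simpa using this
  have h0 := integral_nonneg_of_ae (hnn 0)
  have h1 := integral_nonneg_of_ae (hnn 1)
  rw [hval] at h0 h1
  have l0 := h.left_eq 0
  have l1 := h.left_eq 1
  have hz : ∀ i, ∫ x, ((1 : ℝ) - ∑ k, (x k : ℝ)) ∂(p i) = 0 := fun i => by
    have n0 := mul_nonneg (h.left_pos 0).le h0
    have n1 := mul_nonneg (h.left_pos 1).le h1
    rw [hval]
    revert i
    exact Fin.forall_fin_two.2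
      ⟨(mul_eq_zero.1 (by linarith)).resolve_left (h.left_pos 0).ne',
        (mul_eq_zero.1 (by linarith)).resolve_left (h.left_pos 1).ne'⟩
  intro i
  filter_upwards [(integral_eq_zero_iff_of_nonneg_ae (hnn i) (hint i)).1 (hz i)] with x hx
  have : ((∑ k, x k : ℕ) : ℝ) = 1 := by
    push_cast
    simp only [Pi.zero_apply] at hx
    linarith
  exact_mod_cast this

omit [∀ i, IsProbabilityMeasure (p i)] in
theorem integrable_mul (i j k : Fin 2) :
    Integrable (fun x : Fin 2 → ℕ => (x j : ℝ) * (x k : ℝ)) (p i) :=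
  (h.memLp i j).integrable_mul (h.memLp i k)

theorem halfVariance_eq : halfVariance p u v = ∑ i, v i *
    ∫ x, ((∑ k, (x k : ℝ) * u k) ^ 2 - ∑ k, (x k : ℝ) * u k ^ 2) / 2 ∂(p i) := by
  rw [halfVariance, Finset.mul_sum]
  refine Finset.sum_congr rfl fun i _ => ?_
  have hi : ∀ j k, Integrable (fun x : Fin 2 → ℕ =>
      (x j : ℝ) * ((x k : ℝ) - if j = k then 1 else 0)) (p i) := fun j k => by
    simp only [mul_sub]
    exact (h.integrable_mul i j k).sub ((h.integrable i j).mul_const _)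
  have : ∀ x : Fin 2 → ℕ, ((∑ k, (x k : ℝ) * u k) ^ 2 - ∑ k, (x k : ℝ) * u k ^ 2) / 2
      = ∑ j, ∑ k, ((x j : ℝ) * ((x k : ℝ) - if j = k then 1 else 0)) * (u j * u k / 2) := fun x => by
    simp [Fin.sum_univ_two]
    ring
  simp only [this]
  rw [integral_finsetSum _ fun j _ => integrable_finsetSum _ fun k _ => (hi j k).mul_const _]
  rw [Finset.mul_sum, Finset.mul_sum]
  refine Finset.sum_congr rfl fun j _ => ?_
  rw [integral_finsetSum _ fun k _ => (hi j k).mul_const _, Finset.mul_sum, Finset.mul_sum]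
  refine Finset.sum_congr rfl fun k _ => ?_
  rw [integral_mul_const]
  ring

/-- The decrease of `v ⬝ᵥ q` under the map `genMap p`, to second order. -/
theorem tendsto_dot_sub_div {l : Filter ℕ} [l.IsCountablyGenerated]
    {y : ℕ → ℝ} {r : ℕ → Fin 2 → ℝ} (hy : Tendsto y l (𝓝 0)) (hy0 : ∀ᶠ a in l, 0 < y a)
    (hr : Tendsto r l (𝓝 u)) (h0 : ∀ᶠ a in l, 0 ≤ r a) (h1 : ∀ᶠ a in l, y a • r a ≤ 1) :
    Tendsto (fun a => (v ⬝ᵥ (y a • r a) - v ⬝ᵥ genMap p (y a • r a)) / y a ^ 2) l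
      (𝓝 (halfVariance p u v)) := by
  rw [h.halfVariance_eq]
  refine (tendsto_finsetSum _ fun i _ =>
    (tendsto_sum_sub_escapeMean_div (h.memLp i) hy hy0 hr h0 h1).const_mul (v i)).congr fun a => ?_
  rw [← h.dot_mulVec (y a • r a)]
  simp only [dotProduct, genMap, Matrix.mulVec, meanMatrix, Matrix.of_apply]
  rw [← Finset.sum_sub_distrib, Finset.sum_div]
  refine Finset.sum_congr rfl fun i _ => ?_
  ring

theorem mul_le_dot_sub {q : Fin 2 → ℝ} (h0 : 0 ≤ q) (h1 : q ≤ 1) (i j k : Fin 2) :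
    v i * ((p i).real {x | Pi.single j 1 + Pi.single k 1 ≤ x} * (q j * q k))
      ≤ v ⬝ᵥ q - v ⬝ᵥ genMap p q := by
  rw [← h.dot_mulVec q]
  simp only [dotProduct, ← Finset.sum_sub_distrib, ← mul_sub]
  refine (mul_le_mul_of_nonneg_left (mul_le_sum_sub_escapeMean (h.integrable i) h0 h1 j k)
    (h.left_pos i).le).trans ?_
  refine Finset.single_le_sum (f := fun i => v i * ((meanMatrix p).mulVec q i - genMap p q i))
    (fun l _ => mul_nonneg (h.left_pos l).le ?_) (Finset.mem_univ i)
  exact sub_nonneg.2 (escapeMean_le (h.integrable l) h0 h1)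

theorem halfVariance_pos : 0 < halfVariance p u v := by
  obtain ⟨i, j, k, hp⟩ := h.exists_pair_pos
  have hy : Tendsto (fun n : ℕ => 1 / ((n : ℝ) + 1)) atTop (𝓝 0) :=
    tendsto_one_div_add_atTop_nhds_zero_nat
  have hu1 : u ≤ 1 := fun l => by
    have := h.sum
    rw [Fin.sum_univ_two] at this
    have h0 := h.right_pos 0
    have h1 := h.right_pos 1
    fin_cases l <;> simp <;> linarith
  have hu0 : 0 ≤ u := fun l => (h.right_pos l).le
  have hb : ∀ n : ℕ, (1 / ((n : ℝ) + 1)) • u ≤ 1 := fun n => by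
    refine le_trans ?_ hu1
    refine smul_le_of_le_one_left hu0 ?_
    rw [div_le_one (by positivity)]
    linarith [n.cast_nonneg (α := ℝ)]
  have ht := h.tendsto_dot_sub_div hy (.of_forall fun n => by positivity)
    (tendsto_const_nhds (x := u)) (.of_forall fun _ => hu0) (.of_forall hb)
  refine lt_of_lt_of_le (mul_pos (h.left_pos i) (mul_pos hp (mul_pos (h.right_pos j)
    (h.right_pos k)))) (ge_of_tendsto' ht fun n => ?_)
  rw [le_div_iff₀ (by positivity)]
  refine le_trans (le_of_eq ?_) (h.mul_le_dot_sub
    (smul_nonneg (by positivity : (0:ℝ) ≤ 1 / ((n : ℝ) + 1)) hu0) (hb n) i j k)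
  simp only [Pi.smul_apply, smul_eq_mul]
  ring

end IsCritical

end TwoType

namespace TwoType

theorem le_escape {x : Fin 2 → ℕ} {q : Fin 2 → ℝ} (h0 : 0 ≤ q) (h1 : q ≤ 1) {j : Fin 2}
    (hx : x j ≠ 0) : q j ≤ escape x q := by
  have hle : Pi.single j 1 ≤ x := fun l => by
    rcases eq_or_ne l j with rfl | hl
    · simpa using Nat.one_le_iff_ne_zero.2 hx
    · simp [hl]
  obtain ⟨y, rfl⟩ := exists_add_of_le hle
  rw [add_comm, escape_add_single]
  have hj : q j ≤ 1 := h1 j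
  nlinarith [mul_nonneg (escape_nonneg (x := y) h0 h1) (sub_nonneg.2 hj)]

theorem tendsto_escapeMean {m : Measure (Fin 2 → ℕ)} [IsFiniteMeasure m] {r : ℕ → Fin 2 → ℝ}
    {q : Fin 2 → ℝ} (hr : Tendsto r atTop (𝓝 q)) (h0 : ∀ n, 0 ≤ r n) (h1 : ∀ n, r n ≤ 1) :
    Tendsto (fun n => escapeMean m (r n)) atTop (𝓝 (escapeMean m q)) := by
  refine tendsto_integral_of_dominated_convergence (fun _ => 1)
    (fun _ => aestronglyMeasurable_vec _) (integrable_const _)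
    (fun n => .of_forall fun x => ?_) (.of_forall fun x => ?_)
  · rw [Real.norm_eq_abs, abs_of_nonneg (escape_nonneg (h0 n) (h1 n))]
    exact escape_le_one (h1 n)
  · exact (tendsto_finsetProd _ fun k _ => ((tendsto_pi_nhds.1 hr k).const_sub 1).pow _).const_sub 1

variable {p : Fin 2 → Measure (Fin 2 → ℕ)} {u v : Fin 2 → ℝ}

/-- The survival probabilities up to generation `n`, by the type of the ancestor. -/
noncomputable def survival (p : Fin 2 → Measure (Fin 2 → ℕ)) (n : ℕ) : Fin 2 → ℝ :=
  (genMap p)^[n] 1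

theorem survival_succ (n : ℕ) : survival p (n + 1) = genMap p (survival p n) :=
  Function.iterate_succ_apply' _ _ _

/-- A sequence that satisfies an asymptotically contracting recursion with a vanishing
perturbation tends to zero. -/
theorem tendsto_zero_of_le_mul_add {s r e : ℕ → ℝ} {ρ : ℝ} (hs : ∀ n, 0 ≤ s n) (hρ : ρ < 1)
    (hr : Tendsto r atTop (𝓝 ρ)) (he : Tendsto e atTop (𝓝 0))
    (h : ∀ᶠ n in atTop, s (n + 1) ≤ r n * s n + e n) : Tendsto s atTop (𝓝 0) := by
  obtain ⟨c, hc, hc1⟩ := exists_between (max_lt hρ one_pos)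
  have hc0 : 0 < c := (le_max_right _ _).trans_lt hc
  refine tendsto_order.2 ⟨fun a ha => .of_forall fun n => ha.trans_le (hs n), fun ε hε => ?_⟩
  have hε2 : 0 < ε / 2 * (1 - c) := mul_pos (half_pos hε) (sub_pos.2 hc1)
  obtain ⟨N, hN⟩ := eventually_atTop.1 (h.and ((hr.eventually_lt_const
    ((le_max_left _ _).trans_lt hc)).and (he.eventually_lt_const hε2)))
  have key : ∀ k, s (N + k) - ε / 2 ≤ c ^ k * s N := fun k => by
    induction k with
    | zero => simp; linarith
    | succ k ih =>
      obtain ⟨h1, h2, h3⟩ := hN (N + k) (Nat.le_add_right _ _)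
      rw [← add_assoc, pow_succ]
      nlinarith [mul_le_mul_of_nonneg_right h2.le (hs (N + k))]
  have ht : Tendsto (fun k => c ^ k * s N) atTop (𝓝 0) := by
    simpa using (tendsto_pow_atTop_nhds_zero_of_lt_one hc0.le hc1).mul_const (s N)
  obtain ⟨K, hK⟩ := eventually_atTop.1 (ht.eventually_lt_const (half_pos hε))
  filter_upwards [eventually_ge_atTop (N + K)] with n hn
  obtain ⟨k, rfl⟩ := Nat.exists_eq_add_of_le ((Nat.le_add_right N K).trans hn)
  linarith [key k, hK k (by omega)]

namespace IsCritical

variable (h : IsCritical p u v)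
include h

theorem left_apply_le {q : Fin 2 → ℝ} (h0 : 0 ≤ q) (k : Fin 2) :
    q k ≤ (1 / v 0 + 1 / v 1) * v ⬝ᵥ q := by
  have hv0 := h.left_pos 0
  have hv1 := h.left_pos 1
  have e : (1 / v 0 + 1 / v 1) * v ⬝ᵥ q
      = q 0 + q 1 + (v 1 / v 0 * q 1 + v 0 / v 1 * q 0) := by
    simp only [dotProduct, Fin.sum_univ_two]
    field_simp
    ring
  have h2 : 0 ≤ v 1 / v 0 * q 1 := mul_nonneg (by positivity) (h0 1)
  have h3 : 0 ≤ v 0 / v 1 * q 0 := mul_nonneg (by positivity) (h0 0)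
  have h4 : 0 ≤ q 0 := h0 0
  have h5 : 0 ≤ q 1 := h0 1
  rw [e]
  fin_cases k <;> simp <;> linarith

theorem meanMatrix_offDiag_pos {i j : Fin 2} (hij : i ≠ j) : 0 < meanMatrix p i j := by
  have := isPrimitive_offDiag_pos h.posRegular
  fin_cases i <;> fin_cases j <;> simp at hij ⊢
  exacts [this.1, this.2]

variable [∀ i, IsProbabilityMeasure (p i)]

theorem genMap_pos {q : Fin 2 → ℝ} (h0 : ∀ i, 0 < q i) (h1 : q ≤ 1) (i : Fin 2) :
    0 < genMap p q i := by
  obtain ⟨j, hj⟩ : ∃ j, i ≠ j := ⟨i + 1, by fin_cases i <;> simp⟩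
  have hq : 0 ≤ q := fun k => (h0 k).le
  refine (escapeMean_nonneg hq h1).lt_of_ne' fun hz => (h.meanMatrix_offDiag_pos hj).ne' ?_
  rw [escapeMean, integral_eq_zero_iff_of_nonneg (fun _ => escape_nonneg hq h1)
    (integrable_escape hq h1)] at hz
  rw [meanMatrix, Matrix.of_apply]
  refine integral_eq_zero_of_ae ?_
  filter_upwards [hz] with x hx
  by_contra hn
  exact absurd ((le_escape hq h1 (j := j) fun h => hn (by simp [h])).trans_eq hx) (h0 j).not_ge

omit h in
theorem survival_mem (n : ℕ) : 0 ≤ survival p n ∧ survival p n ≤ 1 :=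
  iterate_genMap_mem zero_le_one le_rfl n

theorem survival_pos (n : ℕ) : ∀ i, 0 < survival p n i := by
  induction n with
  | zero => exact fun i => one_pos
  | succ n ih => rw [survival_succ]; exact h.genMap_pos ih (survival_mem n).2

omit h in
theorem survival_antitone : Antitone (survival p) := by
  refine antitone_nat_of_succ_le fun n => ?_
  rw [survival, survival, Function.iterate_succ_apply]
  exact iterate_genMap_mono (iterate_genMap_mem zero_le_one le_rfl 1).1
    (iterate_genMap_mem zero_le_one le_rfl 1).2 le_rfl n

theorem eq_zero_of_genMap_eq {q : Fin 2 → ℝ} (h0 : 0 ≤ q) (h1 : q ≤ 1) (hq : genMap p q = q) :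
    q = 0 := by
  obtain ⟨i, j, k, hp⟩ := h.exists_pair_pos
  have h2 := h.mul_le_dot_sub h0 h1 i j k
  rw [hq, sub_self] at h2
  have h3 : q j * q k ≤ 0 := by
    by_contra! hn
    exact h2.not_gt (mul_pos (h.left_pos i) (mul_pos hp hn))
  obtain ⟨l, hl⟩ : ∃ l, q l = 0 := by
    rcases mul_eq_zero.1 (h3.antisymm (mul_nonneg (h0 j) (h0 k))) with h | h
    exacts [⟨_, h⟩, ⟨_, h⟩]
  have hle : ∀ i, q i ≤ (meanMatrix p).mulVec q i := fun i => by
    conv_lhs => rw [← hq]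
    exact escapeMean_le (h.integrable i) h0 h1
  have hd := h.dot_mulVec q
  have hv0 := h.left_pos 0
  have hv1 := h.left_pos 1
  simp only [dotProduct, Fin.sum_univ_two] at hd
  have n0 := mul_nonneg hv0.le (sub_nonneg.2 (hle 0))
  have n1 := mul_nonneg hv1.le (sub_nonneg.2 (hle 1))
  have e0 : (meanMatrix p).mulVec q 0 - q 0 = 0 :=
    (mul_eq_zero.1 (by linarith)).resolve_left hv0.ne'
  have e1 : (meanMatrix p).mulVec q 1 - q 1 = 0 :=
    (mul_eq_zero.1 (by linarith)).resolve_left hv1.ne'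
  have hb := h.meanMatrix_offDiag_pos (i := 0) (j := 1) (by simp)
  have hc := h.meanMatrix_offDiag_pos (i := 1) (j := 0) (by simp)
  rw [mulVec_apply_two] at e0 e1
  have hboth : q 0 = 0 ∧ q 1 = 0 := by
    revert l
    refine Fin.forall_fin_two.2 ⟨fun h0 => ⟨h0, ?_⟩, fun h1 => ⟨?_, h1⟩⟩
    · rw [h0] at e0
      exact (mul_eq_zero.1 (by linarith)).resolve_left hb.ne'
    · rw [h1] at e1
      exact (mul_eq_zero.1 (by linarith)).resolve_left hc.ne'
  ext i
  fin_cases i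
  exacts [hboth.1, hboth.2]

/-- Critical processes die out. -/
theorem tendsto_survival : Tendsto (survival p) atTop (𝓝 0) := by
  have hex : ∀ i, ∃ c, Tendsto (fun n => survival p n i) atTop (𝓝 c) := fun i =>
    ⟨_, tendsto_atTop_ciInf (fun _ _ hab => survival_antitone hab i)
      ⟨0, by rintro _ ⟨n, rfl⟩; exact (survival_mem n).1 i⟩⟩
  choose q hq using hex
  have hq' : Tendsto (survival p) atTop (𝓝 q) := tendsto_pi_nhds.2 hq
  have hg : Tendsto (fun n => survival p (n + 1)) atTop (𝓝 (genMap p q)) := by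
    simp only [survival_succ]
    exact tendsto_pi_nhds.2 fun i => tendsto_escapeMean hq' (fun n => (survival_mem n).1)
      fun n => (survival_mem n).2
  have hfix := tendsto_nhds_unique hg ((tendsto_add_atTop_iff_nat 1).2 hq')
  rwa [h.eq_zero_of_genMap_eq (ge_of_tendsto' hq' fun n => (survival_mem n).1)
    (le_of_tendsto' hq' fun n => (survival_mem n).2) hfix] at hq'

/-- The error of the linear approximation of `genMap` is at most quadratic. -/
theorem exists_mulVec_sub_le : ∃ C, 0 ≤ C ∧ ∀ q : Fin 2 → ℝ, 0 ≤ q → q ≤ 1 → ∀ i,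
    (meanMatrix p).mulVec q i - genMap p q i ≤ C * (v ⬝ᵥ q) ^ 2 := by
  set D : Fin 2 → ℝ := fun i => ∫ x, (∑ k, (x k : ℝ)) ^ 2 ∂(p i)
  have hD : ∀ i, 0 ≤ D i := fun i => integral_nonneg fun _ => sq_nonneg _
  refine ⟨(D 0 + D 1) * (1 / v 0 + 1 / v 1) ^ 2,
    mul_nonneg (add_nonneg (hD 0) (hD 1)) (sq_nonneg _), fun q h0 h1 i => ?_⟩
  refine (sum_sub_escapeMean_le (h.memLp i) h0 h1 (h.left_apply_le h0)).trans ?_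
  rw [mul_pow, ← mul_assoc]
  refine mul_le_mul_of_nonneg_right (mul_le_mul_of_nonneg_right ?_ (sq_nonneg _)) (sq_nonneg _)
  change D i ≤ _
  have d0 := hD 0
  have d1 := hD 1
  revert i
  exact Fin.forall_fin_two.2 ⟨by linarith, by linarith⟩

omit [∀ i, IsProbabilityMeasure (p i)] in
theorem right_le_one (i : Fin 2) : u i ≤ 1 := by
  have := h.sum
  rw [Fin.sum_univ_two] at this
  have h0 := h.right_pos 0
  have h1 := h.right_pos 1
  revert i
  exact Fin.forall_fin_two.2 ⟨by linarith, by linarith⟩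

omit h [∀ i, IsProbabilityMeasure (p i)] in
theorem tendsto_dot {r : ℕ → Fin 2 → ℝ} {q : Fin 2 → ℝ} (hr : Tendsto r atTop (𝓝 q)) :
    Tendsto (fun n => v ⬝ᵥ r n) atTop (𝓝 (v ⬝ᵥ q)) :=
  tendsto_finsetSum _ fun i _ => (tendsto_pi_nhds.1 hr i).const_mul _

theorem tendsto_dot_survival : Tendsto (fun n => v ⬝ᵥ survival p n) atTop (𝓝 0) := by
  simpa using tendsto_dot h.tendsto_survival

/-- The direction of the survival probabilities approaches the right eigenvector. -/
theorem tendsto_transverse_survival :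
    Tendsto (fun n => transverse u (survival p n) / v ⬝ᵥ survival p n) atTop (𝓝 0) := by
  obtain ⟨C, hC0, hC⟩ := h.exists_mulVec_sub_le
  have hy := h.tendsto_dot_survival
  have hpos : ∀ n, 0 < v ⬝ᵥ survival p n := fun n => h.dot_pos (h.survival_pos n)
  set c := (v 0 + v 1) * C
  have hden : Tendsto (fun n => 1 - c * v ⬝ᵥ survival p n) atTop (𝓝 1) := by
    simpa using (hy.const_mul c).const_sub 1
  refine (tendsto_zero_iff_abs_tendsto_zero _).2 (tendsto_zero_of_le_mul_add
    (r := fun n => |secondEigenvalue p| / (1 - c * v ⬝ᵥ survival p n))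
    (e := fun n => (2 * C) * v ⬝ᵥ survival p n / (1 - c * v ⬝ᵥ survival p n))
    (fun n => abs_nonneg _) h.abs_secondEigenvalue_lt_one ?_ ?_ ?_)
  · have := (tendsto_const_nhds (x := |secondEigenvalue p|)).div hden one_ne_zero
    rwa [div_one] at this
  · have := (hy.const_mul (2 * C)).div hden one_ne_zero
    rwa [mul_zero, zero_div] at this
  · filter_upwards [hden.eventually_const_lt one_pos] with n hn
    set q := survival p n with hq
    have hm := survival_mem (p := p) n
    have hd := hC q hm.1 hm.2
    have hd' : ∀ i, genMap p q i ≤ (meanMatrix p).mulVec q i := fun i =>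
      escapeMean_le (h.integrable i) hm.1 hm.2
    have hlow : (v ⬝ᵥ q) * (1 - c * v ⬝ᵥ q) ≤ v ⬝ᵥ genMap p q := by
      have e := h.dot_mulVec q
      have hv0 := h.left_pos 0
      have hv1 := h.left_pos 1
      have t0 := mul_le_mul_of_nonneg_left (hd 0) hv0.le
      have t1 := mul_le_mul_of_nonneg_left (hd 1) hv1.le
      have e2 : v ⬝ᵥ (meanMatrix p).mulVec q - v ⬝ᵥ genMap p q
        = v 0 * ((meanMatrix p).mulVec q 0 - genMap p q 0)
          + v 1 * ((meanMatrix p).mulVec q 1 - genMap p q 1) := by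
        simp only [dotProduct, Fin.sum_univ_two]; ring
      have e3 : c = (v 0 + v 1) * C := rfl
      rw [e3]
      nlinarith
    have hz : |transverse u (genMap p q)| ≤ |secondEigenvalue p| * |transverse u q|
        + 2 * C * (v ⬝ᵥ q) ^ 2 := by
      have e : transverse u (genMap p q) = secondEigenvalue p * transverse u q
          + (u 0 * ((meanMatrix p).mulVec q 1 - genMap p q 1)
            - u 1 * ((meanMatrix p).mulVec q 0 - genMap p q 0)) := by
        rw [← h.transverse_mulVec]
        simp only [transverse]
        ring
      rw [e]
      refine (abs_add_le _ _).trans (add_le_add (abs_mul _ _).le ?_)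
      have t : ∀ i j, 0 ≤ u i * ((meanMatrix p).mulVec q j - genMap p q j) ∧
          u i * ((meanMatrix p).mulVec q j - genMap p q j) ≤ C * (v ⬝ᵥ q) ^ 2 := fun i j =>
        ⟨mul_nonneg (h.right_pos i).le (sub_nonneg.2 (hd' j)),
          (mul_le_of_le_one_left (sub_nonneg.2 (hd' j)) (h.right_le_one i)).trans (hd j)⟩
      rw [abs_le]
      constructor <;> linarith [(t 0 1).1, (t 0 1).2, (t 1 0).1, (t 1 0).2]
    have hyn := hpos n
    rw [← hq] at hyn
    simp only [Function.comp]
    rw [survival_succ, ← hq, abs_div, abs_div, abs_of_pos hyn,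
      abs_of_pos ((mul_pos hyn hn).trans_le hlow)]
    calc _ ≤ (|secondEigenvalue p| * |transverse u q| + 2 * C * (v ⬝ᵥ q) ^ 2)
          / ((v ⬝ᵥ q) * (1 - c * v ⬝ᵥ q)) :=
          div_le_div₀ (by positivity) hz (mul_pos hyn hn) hlow
      _ = _ := by field_simp

theorem tendsto_survival_direction :
    Tendsto (fun n => (v ⬝ᵥ survival p n)⁻¹ • survival p n) atTop (𝓝 u) := by
  have ht : Tendsto (fun n => u + (transverse u (survival p n) / v ⬝ᵥ survival p n)
      • ![v 1, -v 0]) atTop (𝓝 (u + (0 : ℝ) • ![v 1, -v 0])) :=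
    (h.tendsto_transverse_survival.smul_const _).const_add _
  rw [zero_smul, add_zero] at ht
  refine ht.congr fun n => ?_
  have hpos := h.dot_pos (h.survival_pos n)
  have e := congrArg ((v ⬝ᵥ survival p n)⁻¹ • ·) (h.eq_dot_smul_add (survival p n))
  simp only [smul_add, smul_smul, inv_mul_cancel₀ hpos.ne', one_smul] at e
  rw [e, div_eq_inv_mul]

/-- Kolmogorov's estimate: the survival probabilities decay like `u / (B n)`. -/
theorem tendsto_nat_mul_survival :
    Tendsto (fun n : ℕ => (n : ℝ) • survival p n) atTop (𝓝 ((halfVariance p u v)⁻¹ • u)) := by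
  set y := fun n => v ⬝ᵥ survival p n with hy_def
  have hpos : ∀ n, 0 < y n := fun n => h.dot_pos (h.survival_pos n)
  have hy : Tendsto y atTop (𝓝 0) := h.tendsto_dot_survival
  have hB := h.halfVariance_pos
  have e : ∀ n, y n • (y n)⁻¹ • survival p n = survival p n := fun n => by
    rw [smul_smul, mul_inv_cancel₀ (hpos n).ne', one_smul]
  have hdiff' := h.tendsto_dot_sub_div hy (.of_forall hpos) h.tendsto_survival_direction
    (.of_forall fun n => smul_nonneg (inv_nonneg.2 (hpos n).le) (survival_mem n).1)
    (.of_forall fun n => by rw [e]; exact (survival_mem n).2)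
  have hdiff : Tendsto (fun n => (y n - y (n + 1)) / y n ^ 2) atTop (𝓝 (halfVariance p u v)) :=
    hdiff'.congr fun n => by rw [e]; simp only [hy_def, survival_succ]
  have hratio : Tendsto (fun n => y (n + 1) / y n) atTop (𝓝 1) := by
    have := (hy.mul hdiff).const_sub 1
    rw [zero_mul, sub_zero] at this
    refine this.congr fun n => ?_
    have := hpos n
    field_simp
    ring
  have hinc : Tendsto (fun n => (y (n + 1))⁻¹ - (y n)⁻¹) atTop (𝓝 (halfVariance p u v)) := by
    have := hdiff.div hratio one_ne_zero
    rw [div_one] at this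
    refine this.congr fun n => ?_
    have := hpos n
    have := hpos (n + 1)
    simp only [Pi.div_apply]
    field_simp
  have hces := hinc.cesaro
  simp only [Finset.sum_range_sub fun n => (y n)⁻¹] at hces
  have h0 : Tendsto (fun n : ℕ => (n : ℝ)⁻¹ * (y 0)⁻¹) atTop (𝓝 0) := by
    simpa using tendsto_inv_atTop_nhds_zero_nat.mul_const (y 0)⁻¹
  have h1 := (hces.add h0).inv₀ (by simpa using hB.ne')
  rw [add_zero] at h1
  have h2 := h1.smul h.tendsto_survival_direction
  refine h2.congr fun n => ?_
  rw [← mul_add, sub_add_cancel, ← mul_inv, inv_inv, smul_smul]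
  change (n * y n * (y n)⁻¹) • _ = _
  rw [mul_inv_cancel_right₀ (hpos n).ne']

end IsCritical

end TwoType

namespace TwoType

variable {p : Fin 2 → Measure (Fin 2 → ℕ)} {u v : Fin 2 → ℝ}

theorem tendsto_nat_mul_escapeMean {m : Measure (Fin 2 → ℕ)}
    (hm : ∀ k, Integrable (fun x : Fin 2 → ℕ => (x k : ℝ)) m) {w : ℕ → Fin 2 → ℝ}
    {q : Fin 2 → ℝ} (hw : Tendsto (fun n : ℕ => (n : ℝ) • w n) atTop (𝓝 q))
    (h0 : ∀ n, 0 ≤ w n) (h1 : ∀ n, w n ≤ 1) :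
    Tendsto (fun n : ℕ => n * escapeMean m (w n)) atTop
      (𝓝 (∑ k, (∫ x, (x k : ℝ) ∂m) * q k)) := by
  have e : ∀ᶠ n : ℕ in atTop, (n : ℝ)⁻¹ • (n : ℝ) • w n = w n := by
    filter_upwards [eventually_gt_atTop 0] with n hn
    rw [inv_smul_smul₀ (by positivity)]
  refine (tendsto_escapeMean_div hm tendsto_inv_atTop_nhds_zero_nat ?_ hw ?_ ?_).congr' ?_
  · filter_upwards [eventually_gt_atTop 0] with n hn
    positivity
  · exact .of_forall fun n => smul_nonneg n.cast_nonneg (h0 n)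
  · filter_upwards [e] with n hn
    rw [hn]
    exact h1 n
  · filter_upwards [e] with n hn
    rw [hn, div_inv_eq_mul, mul_comm]

namespace IsCritical

variable (h : IsCritical p u v)
include h

theorem tendsto_iterate_mulVec (q : Fin 2 → ℝ) :
    Tendsto (fun k => (meanMatrix p).mulVec^[k] q) atTop (𝓝 ((v ⬝ᵥ q) • u)) := by
  have hdot : ∀ k, v ⬝ᵥ (meanMatrix p).mulVec^[k] q = v ⬝ᵥ q := fun k => by
    induction k with
    | zero => rfl
    | succ k ih => rw [Function.iterate_succ_apply', h.dot_mulVec, ih]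
  have htr : ∀ k, transverse u ((meanMatrix p).mulVec^[k] q)
      = secondEigenvalue p ^ k * transverse u q := fun k => by
    induction k with
    | zero => simp
    | succ k ih => rw [Function.iterate_succ_apply', h.transverse_mulVec, ih, pow_succ]; ring
  have h2 := (((tendsto_pow_atTop_nhds_zero_of_abs_lt_one h.abs_secondEigenvalue_lt_one).mul_const
    (transverse u q)).smul_const ![v 1, -v 0]).const_add ((v ⬝ᵥ q) • u)
  rw [zero_mul, zero_smul, add_zero] at h2
  refine h2.congr fun k => ?_
  rw [← htr]
  nth_rw 1 [← hdot k]
  exact (h.eq_dot_smul_add _).symm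

variable [∀ i, IsProbabilityMeasure (p i)]

theorem tendsto_nat_mul_iterate {w : ℕ → Fin 2 → ℝ} {q : Fin 2 → ℝ}
    (hw : Tendsto (fun n : ℕ => (n : ℝ) • w n) atTop (𝓝 q))
    (h0 : ∀ n, 0 ≤ w n) (h1 : ∀ n, w n ≤ 1) (k : ℕ) :
    Tendsto (fun n : ℕ => (n : ℝ) • (genMap p)^[k] (w n)) atTop
      (𝓝 ((meanMatrix p).mulVec^[k] q)) := by
  induction k with
  | zero => exact hw
  | succ k ih =>
    simp only [Function.iterate_succ_apply']
    exact tendsto_pi_nhds.2 fun i => tendsto_nat_mul_escapeMean (h.integrable i) ih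
      (fun n => (iterate_genMap_mem (h0 n) (h1 n) k).1)
      fun n => (iterate_genMap_mem (h0 n) (h1 n) k).2

theorem tendsto_nat_mul_survival_comp {m : ℕ → ℕ} {γ : ℝ} (hγ : 0 < γ)
    (hm : Tendsto (fun n : ℕ => (m n : ℝ) / n) atTop (𝓝 γ)) :
    Tendsto (fun n : ℕ => (n : ℝ) • survival p (m n)) atTop
      (𝓝 ((halfVariance p u v * γ)⁻¹ • u)) := by
  have hinf : Tendsto m atTop atTop := by
    rw [← tendsto_natCast_atTop_iff (R := ℝ)]
    refine (hm.pos_mul_atTop hγ tendsto_natCast_atTop_atTop).congr' ?_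
    filter_upwards [eventually_gt_atTop 0] with n hn
    field_simp
  have h2 := (hm.inv₀ hγ.ne').smul (h.tendsto_nat_mul_survival.comp hinf)
  rw [smul_smul, ← mul_inv, mul_comm γ] at h2
  refine h2.congr' ?_
  filter_upwards [hinf.eventually_gt_atTop 0] with n hn
  simp only [Function.comp, smul_smul]
  congr 1
  field_simp

/-- Survival probabilities that start at `η • u / n` and evolve for `n` more generations. -/
theorem exists_survival_start {η : ℝ} (hη : 0 < η) : ∃ m : ℕ → ℕ,
    Tendsto (fun n : ℕ => (n : ℝ) • survival p (m n)) atTop (𝓝 (η • u)) ∧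
    ∀ k : ℕ, Tendsto (fun n : ℕ => (n : ℝ) • (genMap p)^[n - k] (survival p (m n))) atTop
      (𝓝 ((η / (1 + halfVariance p u v * η)) • u)) := by
  have hB := h.halfVariance_pos
  set B := halfVariance p u v with hB_def
  have hβ : 0 < (B * η)⁻¹ := by positivity
  have hm : Tendsto (fun n : ℕ => (⌊(B * η)⁻¹ * (n : ℝ)⌋₊ : ℝ) / n) atTop (𝓝 (B * η)⁻¹) :=
    (tendsto_nat_floor_mul_div_atTop hβ.le).comp tendsto_natCast_atTop_atTop
  refine ⟨fun n => ⌊(B * η)⁻¹ * (n : ℝ)⌋₊, ?_, fun k => ?_⟩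
  · convert h.tendsto_nat_mul_survival_comp hβ hm using 3
    rw [← hB_def]
    field_simp
  · have hm2 : Tendsto (fun n : ℕ => ((n - k + ⌊(B * η)⁻¹ * (n : ℝ)⌋₊ : ℕ) : ℝ) / n) atTop
        (𝓝 (1 + (B * η)⁻¹)) := by
      have h1 : Tendsto (fun n : ℕ => 1 - (k : ℝ) * (n : ℝ)⁻¹) atTop (𝓝 1) := by
        simpa using (tendsto_inv_atTop_nhds_zero_nat.const_mul (k : ℝ)).const_sub 1
      refine (h1.add hm).congr' ?_
      filter_upwards [eventually_ge_atTop k, eventually_gt_atTop 0] with n hn hn0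
      push_cast [Nat.cast_sub hn]
      field_simp
    have e : ((η / (1 + B * η)) • u) = (B * (1 + (B * η)⁻¹))⁻¹ • u := by
      congr 1
      field_simp
      ring
    rw [e]
    refine (h.tendsto_nat_mul_survival_comp (by positivity) hm2).congr fun n => ?_
    rw [survival, survival, ← Function.iterate_add_apply]

omit h [∀ i, IsProbabilityMeasure (p i)] in
theorem eventually_le_of_tendsto {a b : ℕ → Fin 2 → ℝ} {α β : Fin 2 → ℝ}
    (ha : Tendsto (fun n : ℕ => (n : ℝ) • a n) atTop (𝓝 α))
    (hb : Tendsto (fun n : ℕ => (n : ℝ) • b n) atTop (𝓝 β)) (hlt : ∀ i, α i < β i) :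
    ∀ᶠ n in atTop, a n ≤ b n := by
  have : ∀ i, ∀ᶠ n in atTop, a n i ≤ b n i := fun i => by
    filter_upwards [(tendsto_pi_nhds.1 ha i).eventually_lt (tendsto_pi_nhds.1 hb i) (hlt i),
      eventually_gt_atTop 0] with n hn hn0
    simp only [Pi.smul_apply, smul_eq_mul] at hn
    exact le_of_mul_le_mul_left hn.le (by positivity)
  filter_upwards [eventually_all.2 this] with n hn using hn

section bounds

variable {w : ℕ → Fin 2 → ℝ} {q : Fin 2 → ℝ} {η t : ℝ}

theorem eventually_lt_iterate (hw : Tendsto (fun n : ℕ => (n : ℝ) • w n) atTop (𝓝 q))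
    (h0 : ∀ n, 0 ≤ w n) (h1 : ∀ n, w n ≤ 1) (hη : 0 < η) (hηq : η < v ⬝ᵥ q)
    (ht : t < η / (1 + halfVariance p u v * η)) (i : Fin 2) :
    ∀ᶠ n : ℕ in atTop, t * u i < n * (genMap p)^[n] (w n) i := by
  obtain ⟨m, hm, hmk⟩ := h.exists_survival_start hη
  obtain ⟨k, hk⟩ : ∃ k, ∀ i, (η • u) i < (meanMatrix p).mulVec^[k] q i :=
    (eventually_all.2 fun i => (tendsto_pi_nhds.1 (h.tendsto_iterate_mulVec q) i).eventually_const_lt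
      (mul_lt_mul_of_pos_right hηq (h.right_pos i))).exists
  have hlt := (tendsto_pi_nhds.1 (hmk k) i).eventually_const_lt
    (mul_lt_mul_of_pos_right ht (h.right_pos i))
  filter_upwards [eventually_le_of_tendsto hm (h.tendsto_nat_mul_iterate hw h0 h1 k) hk, hlt,
    eventually_ge_atTop k] with n hle hn hkn
  refine hn.trans_le (mul_le_mul_of_nonneg_left ?_ n.cast_nonneg)
  have e : (genMap p)^[n] (w n) = (genMap p)^[n - k] ((genMap p)^[k] (w n)) := by
    rw [← Function.iterate_add_apply, Nat.sub_add_cancel hkn]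
  rw [e]
  exact iterate_genMap_mono (survival_mem _).1 hle (iterate_genMap_mem (h0 n) (h1 n) k).2 _ i

theorem eventually_iterate_lt (hw : Tendsto (fun n : ℕ => (n : ℝ) • w n) atTop (𝓝 q))
    (h0 : ∀ n, 0 ≤ w n) (h1 : ∀ n, w n ≤ 1) (hη : 0 < η) (hηq : v ⬝ᵥ q < η)
    (ht : η / (1 + halfVariance p u v * η) < t) (i : Fin 2) :
    ∀ᶠ n : ℕ in atTop, n * (genMap p)^[n] (w n) i < t * u i := by
  obtain ⟨m, hm, hmk⟩ := h.exists_survival_start hη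
  obtain ⟨k, hk⟩ : ∃ k, ∀ i, (meanMatrix p).mulVec^[k] q i < (η • u) i :=
    (eventually_all.2 fun i => (tendsto_pi_nhds.1 (h.tendsto_iterate_mulVec q) i).eventually_lt_const
      (mul_lt_mul_of_pos_right hηq (h.right_pos i))).exists
  have hlt := (tendsto_pi_nhds.1 (hmk k) i).eventually_lt_const
    (mul_lt_mul_of_pos_right ht (h.right_pos i))
  filter_upwards [eventually_le_of_tendsto (h.tendsto_nat_mul_iterate hw h0 h1 k) hm hk, hlt,
    eventually_ge_atTop k] with n hle hn hkn
  refine lt_of_le_of_lt (mul_le_mul_of_nonneg_left ?_ n.cast_nonneg) hn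
  have e : (genMap p)^[n] (w n) = (genMap p)^[n - k] ((genMap p)^[k] (w n)) := by
    rw [← Function.iterate_add_apply, Nat.sub_add_cancel hkn]
  rw [e]
  exact iterate_genMap_mono (iterate_genMap_mem (h0 n) (h1 n) k).1 hle (survival_mem _).2 _ i

end bounds

omit [∀ i, IsProbabilityMeasure (p i)] in
theorem tendsto_of_forall_eventually {a : ℕ → Fin 2 → ℝ} {c : ℝ}
    (hl : ∀ t < c, ∀ i, ∀ᶠ n : ℕ in atTop, t * u i < n * a n i)
    (hu : ∀ t > c, ∀ i, ∀ᶠ n : ℕ in atTop, n * a n i < t * u i) :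
    Tendsto (fun n : ℕ => (n : ℝ) • a n) atTop (𝓝 (c • u)) := by
  refine tendsto_pi_nhds.2 fun i => tendsto_order.2 ⟨fun s hs => ?_, fun s hs => ?_⟩
  all_goals
    simp only [Pi.smul_apply, smul_eq_mul] at hs ⊢
    have := h.right_pos i
  · filter_upwards [hl (s / u i) ((div_lt_iff₀ this).2 hs) i] with n hn
    rwa [div_mul_cancel₀ _ this.ne'] at hn
  · filter_upwards [hu (s / u i) ((lt_div_iff₀ this).2 hs) i] with n hn
    rwa [div_mul_cancel₀ _ this.ne'] at hn

omit h [∀ i, IsProbabilityMeasure (p i)] in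
theorem continuousAt_div_one_add {B κ : ℝ} (hB : 0 < B) (hκ : 0 ≤ κ) :
    ContinuousAt (fun η => η / (1 + B * η)) κ :=
  continuousAt_id.div (by fun_prop) (by positivity)

/-- The generating functions at arguments that approach `1` at rate `1 / n`. -/
theorem tendsto_nat_mul_iterate_self {w : ℕ → Fin 2 → ℝ} {q : Fin 2 → ℝ}
    (hw : Tendsto (fun n : ℕ => (n : ℝ) • w n) atTop (𝓝 q))
    (h0 : ∀ n, 0 ≤ w n) (h1 : ∀ n, w n ≤ 1) :
    Tendsto (fun n : ℕ => (n : ℝ) • (genMap p)^[n] (w n)) atTop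
      (𝓝 ((v ⬝ᵥ q / (1 + halfVariance p u v * v ⬝ᵥ q)) • u)) := by
  have hB := h.halfVariance_pos
  have hq : 0 ≤ q := ge_of_tendsto' hw fun n => smul_nonneg n.cast_nonneg (h0 n)
  have hκ := h.dot_nonneg hq
  have hcont := continuousAt_div_one_add hB hκ
  refine h.tendsto_of_forall_eventually (fun t ht i => ?_) fun t ht i => ?_
  · rcases hκ.eq_or_lt with hz | hpos
    · rw [← hz, zero_div] at ht
      filter_upwards with n
      exact (mul_neg_of_neg_of_pos ht (h.right_pos i)).trans_le
        (mul_nonneg n.cast_nonneg ((iterate_genMap_mem (h0 n) (h1 n) n).1 i))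
    · obtain ⟨η, hη, hη1, hη0⟩ := ((hcont.tendsto.mono_left (nhdsWithin_le_nhds
        (s := Set.Iio (v ⬝ᵥ q)))).eventually_const_lt ht |>.and
        (eventually_mem_nhdsWithin.and (nhdsWithin_le_nhds (lt_mem_nhds hpos)))).exists
      exact h.eventually_lt_iterate hw h0 h1 hη0 hη1 hη i
  · obtain ⟨η, hη, hη1⟩ := ((hcont.tendsto.mono_left (nhdsWithin_le_nhds
      (s := Set.Ioi (v ⬝ᵥ q)))).eventually_lt_const ht |>.and eventually_mem_nhdsWithin).exists
    exact h.eventually_iterate_lt hw h0 h1 (hκ.trans_lt hη1) hη1 hη i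

/-- The generating functions at arguments that approach `1` more slowly than `1 / n`, or do not
approach it. -/
theorem tendsto_nat_mul_iterate_self_of_atTop {w : ℕ → Fin 2 → ℝ}
    (hw : Tendsto (fun n : ℕ => n * w n 0) atTop atTop)
    (h0 : ∀ n, 0 ≤ w n) (h1 : ∀ n, w n ≤ 1) :
    Tendsto (fun n : ℕ => (n : ℝ) • (genMap p)^[n] (w n)) atTop
      (𝓝 ((halfVariance p u v)⁻¹ • u)) := by
  have hB := h.halfVariance_pos
  set B := halfVariance p u v with hB_def
  refine h.tendsto_of_forall_eventually (fun t ht i => ?_) fun t ht i => ?_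
  · have hlim : Tendsto (fun η : ℝ => η / (1 + B * η)) atTop (𝓝 B⁻¹) := by
      have := ((tendsto_inv_atTop_zero (𝕜 := ℝ)).add_const B).inv₀ (by simpa using hB.ne')
      rw [zero_add] at this
      refine this.congr' ?_
      filter_upwards [eventually_gt_atTop 0] with η hη
      field_simp
    obtain ⟨η, hη, hη0⟩ := ((hlim.eventually_const_lt ht).and (eventually_gt_atTop 0)).exists
    obtain ⟨K, hK⟩ : ∃ K, η < v 0 * K := ⟨(η + 1) / v 0, by
      rw [mul_div_cancel₀ _ (h.left_pos 0).ne']; exact lt_add_one η⟩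
    have hKpos : 0 < K := pos_of_mul_pos_right (hη0.trans hK) (h.left_pos 0).le
    set w' : ℕ → Fin 2 → ℝ := fun n => ![min (w n 0) (K / n), 0] with hw'
    have hw'0 : ∀ n, 0 ≤ w' n := fun n => Fin.forall_fin_two.2
      ⟨le_min (h0 n 0) (by positivity), le_rfl⟩
    have hw'w : ∀ n, w' n ≤ w n := fun n => Fin.forall_fin_two.2 ⟨min_le_left _ _, h0 n 1⟩
    have hlim' : Tendsto (fun n : ℕ => (n : ℝ) • w' n) atTop (𝓝 ![K, 0]) := by
      refine tendsto_const_nhds.congr' ?_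
      filter_upwards [hw.eventually_ge_atTop K, eventually_gt_atTop 0] with n hn hn0
      have hn0' : (0 : ℝ) < n := by exact_mod_cast hn0
      have : min (w n 0) (K / n) = K / n := min_eq_right ((div_le_iff₀' hn0').2 hn)
      simp only [hw', this]
      ext i
      fin_cases i
      · simp; field_simp
      · simp
    have := h.eventually_lt_iterate hlim' hw'0 (fun n => (hw'w n).trans (h1 n)) hη0
      (by simpa [dotProduct, Fin.sum_univ_two] using hK) hη i
    filter_upwards [this] with n hn
    exact hn.trans_le (mul_le_mul_of_nonneg_left
      (iterate_genMap_mono (hw'0 n) (hw'w n) (h1 n) n i) n.cast_nonneg)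
  · have hs := (tendsto_pi_nhds.1 h.tendsto_nat_mul_survival i).eventually_lt_const
      (mul_lt_mul_of_pos_right ht (h.right_pos i))
    filter_upwards [hs] with n hn
    exact (mul_le_mul_of_nonneg_left (iterate_genMap_mono (h0 n) (h1 n) le_rfl n i)
      n.cast_nonneg).trans_lt hn

end IsCritical

end TwoType

namespace TwoType

section independence

variable {Ω : Type*} [mΩ : MeasurableSpace Ω] {μ : Measure Ω} [IsProbabilityMeasure μ]

theorem indepFun_prodMk_left {α β γ : Type*} [MeasurableSpace α] [MeasurableSpace β]
    [MeasurableSpace γ] {f : Ω → α} {g : Ω → β} {k : Ω → γ} (hf : Measurable f)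
    (hg : Measurable g) (hk : Measurable k) (h : IndepFun f (fun ω => (g ω, k ω)) μ)
    (hgk : IndepFun g k μ) : IndepFun (fun ω => (f ω, g ω)) k μ := by
  have hfg : IndepFun f g μ := h.comp measurable_id measurable_fst
  rw [indepFun_iff_map_prod_eq_prod_map_map (by fun_prop) (by fun_prop)] at h hgk hfg ⊢
  have : IsProbabilityMeasure (μ.map k) := Measure.isProbabilityMeasure_map (by fun_prop)
  rw [hgk, ← Measure.prodAssoc_prod, ← hfg] at h
  have h2 := congrArg (Measure.map MeasurableEquiv.prodAssoc.symm) h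
  rw [MeasurableEquiv.map_symm_map] at h2
  rw [← h2, Measure.map_map (by fun_prop) (by fun_prop)]
  rfl

omit mΩ in
theorem comap_pi_le_iSup {ι κ β : Type*} [MeasurableSpace β] (f : ι → Ω → β) (g : κ → ι)
    {T : Set ι} (hg : ∀ s, g s ∈ T) :
    MeasurableSpace.comap (fun ω s => f (g s) ω) MeasurableSpace.pi
      ≤ ⨆ q ∈ T, MeasurableSpace.comap (f q) inferInstance := by
  rw [MeasurableSpace.pi, MeasurableSpace.comap_iSup]
  refine iSup_le fun s => ?_
  rw [MeasurableSpace.comap_comp]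
  exact le_iSup₂_of_le (f := fun q (_ : q ∈ T) => MeasurableSpace.comap (f q) inferInstance)
    (g s) (hg s) le_rfl

/-- The expectation of a product of a random number of independent factors. -/
theorem integral_mul_prod_range {N : Ω → Fin 2 → ℕ} {Y : Fin 2 → ℕ → Ω → ℝ} {φ : Fin 2 → ℝ}
    {G : (Fin 2 → ℕ) → ℝ} (hN : Measurable N) (hY : ∀ i j, Measurable (Y i j))
    (hY0 : ∀ i j ω, 0 ≤ Y i j ω) (hY1 : ∀ i j ω, Y i j ω ≤ 1)
    (hNY : IndepFun N (fun ω (q : Fin 2 × ℕ) => Y q.1 q.2 ω) μ)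
    (hYi : iIndepFun (fun (q : Fin 2 × ℕ) ω => Y q.1 q.2 ω) μ)
    (hφ : ∀ i j, ∫ ω, Y i j ω ∂μ = φ i) (hG : ∀ z, |G z| ≤ 1) :
    ∫ ω, G (N ω) * ∏ i, ∏ j ∈ Finset.range (N ω i), Y i j ω ∂μ
      = ∫ ω, G (N ω) * ∏ i, φ i ^ N ω i ∂μ := by
  set Y' : Ω → Fin 2 × ℕ → ℝ := fun ω q => Y q.1 q.2 ω with hY'
  have hY'm : Measurable Y' := measurable_pi_iff.2 fun q => hY q.1 q.2
  set f : (Fin 2 → ℕ) × (Fin 2 × ℕ → ℝ) → ℝ := fun a =>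
    G a.1 * ∏ i, ∏ j ∈ Finset.range (a.1 i), a.2 (i, j) with hf
  have hfm : Measurable f := measurable_from_prod_countable_right fun z => by
    simp only [hf]
    refine (Finset.measurable_prod _ fun i _ => Finset.measurable_prod _ fun j _ => ?_).const_mul _
    exact measurable_pi_apply (i, j)
  have hpm : Measurable fun ω => (N ω, Y' ω) := hN.prodMk hY'm
  have hmap := (indepFun_iff_map_prod_eq_prod_map_map hN.aemeasurable hY'm.aemeasurable).1 hNY
  have hint : Integrable f ((μ.map N).prod (μ.map Y')) := by
    rw [← hmap, integrable_map_measure hfm.aestronglyMeasurable hpm.aemeasurable]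
    refine (integrable_const (1 : ℝ)).mono' (hfm.comp hpm).aestronglyMeasurable
      (.of_forall fun ω => ?_)
    have h0 : 0 ≤ ∏ i, ∏ j ∈ Finset.range (N ω i), Y i j ω :=
      Finset.prod_nonneg fun i _ => Finset.prod_nonneg fun j _ => hY0 i j ω
    have h1 : ∏ i, ∏ j ∈ Finset.range (N ω i), Y i j ω ≤ 1 :=
      Finset.prod_le_one (fun i _ => Finset.prod_nonneg fun j _ => hY0 i j ω) fun i _ =>
        Finset.prod_le_one (fun j _ => hY0 i j ω) fun j _ => hY1 i j ω
    simp only [hf, hY', Function.comp, Real.norm_eq_abs, abs_mul, abs_of_nonneg h0]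
    exact mul_le_one₀ (hG _) h0 h1
  have hinner : ∀ z, ∫ y, f (z, y) ∂(μ.map Y') = G z * ∏ i, φ i ^ z i := fun z => by
    have hfz : AEStronglyMeasurable (fun y => f (z, y)) (μ.map Y') :=
      (hfm.comp measurable_prodMk_left).aestronglyMeasurable
    rw [integral_map hY'm.aemeasurable hfz]
    simp only [hf, hY', integral_const_mul]
    congr 1
    have hinj : Function.Injective (fun s : (i : Fin 2) × Fin (z i) => (s.1, (s.2 : ℕ))) := by
      rintro ⟨i, j⟩ ⟨i', j'⟩ he
      simp only [Prod.mk.injEq] at he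
      obtain ⟨rfl, he⟩ := he
      rw [Fin.ext he]
    have hprod := (hYi.precomp hinj).integral_fun_prod_eq_prod_integral
      fun s => (hY s.1 s.2).aestronglyMeasurable
    simp only [Fintype.prod_sigma, hφ] at hprod
    simpa [Finset.prod_range] using hprod
  calc _ = ∫ a, f a ∂((μ.map N).prod (μ.map Y')) := by
        rw [← hmap, integral_map hpm.aemeasurable hfm.aestronglyMeasurable]
    _ = ∫ z, G z * ∏ i, φ i ^ z i ∂(μ.map N) := by
        rw [integral_prod _ hint]
        simp only [hinner]
    _ = _ := integral_map hN.aemeasurable (aestronglyMeasurable_vec _)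

end independence

section size

variable {Ω : Type*} {Z₀ : Ω → Fin 2 → ℕ} {X : Fin 2 → ℕ → ℕ → Ω → Fin 2 → ℕ}

theorem measurable_size {𝓕 : MeasurableSpace Ω} {n : ℕ} (h0 : Measurable Z₀)
    (hX : ∀ i m j, m ≤ n → Measurable (X i m j)) : Measurable (size Z₀ X n) := by
  induction n with
  | zero => exact h0
  | succ n ih =>
    have ih := ih fun i m j hm => hX i m j (hm.trans n.le_succ)
    refine measurable_pi_iff.2 fun k => ?_
    have hF : Measurable fun a : (Fin 2 → ℕ) × Ω =>
        ∑ i, ∑ j ∈ Finset.range (a.1 i), X i (n + 1) j a.2 k :=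
      measurable_from_prod_countable_right fun z => by
        refine Finset.measurable_sum Finset.univ fun i _ =>
          Finset.measurable_sum (Finset.range (z i)) fun j _ => ?_
        exact (measurable_pi_apply k).comp (hX i _ j le_rfl)
    exact hF.comp (ih.prodMk measurable_id)

end size

namespace IsScoredProcess

variable {Ω : Type*} [mΩ : MeasurableSpace Ω] {μ : Measure Ω} [IsProbabilityMeasure μ]
  {p : Fin 2 → Measure (Fin 2 → ℕ)} {S : Fin 2 → Measure ℝ}
  {Z₀ : Ω → Fin 2 → ℕ} {X : Fin 2 → ℕ → ℕ → Ω → Fin 2 → ℕ} {ζ : Fin 2 → ℕ → ℕ → Ω → ℝ}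
  (h : IsScoredProcess μ p S Z₀ X ζ)
include h

omit [IsProbabilityMeasure μ] in
theorem measurable_size (n : ℕ) : Measurable (size Z₀ X n) :=
  TwoType.measurable_size h.measurable_init fun i m j _ => h.measurable_offspring i m j

theorem indepFun_size_offspring (n : ℕ) :
    IndepFun (size Z₀ X n) (fun ω (q : Fin 2 × ℕ) => X q.1 (n + 1) q.2 ω) μ := by
  set a : Ω → {q : Fin 2 × ℕ × ℕ // q.2.1 ≤ n} → Fin 2 → ℕ :=
    fun ω q => X q.1.1 q.1.2.1 q.1.2.2 ω with ha
  set b : Ω → Fin 2 × ℕ → Fin 2 → ℕ := fun ω q => X q.1 (n + 1) q.2 ω with hb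
  have ham : Measurable a := measurable_pi_iff.2 fun q => h.measurable_offspring _ _ _
  have hbm : Measurable b := measurable_pi_iff.2 fun q => h.measurable_offspring _ _ _
  have h1 : IndepFun Z₀ (fun ω => (a ω, b ω)) μ := by
    have hψ : Measurable fun y : Fin 2 × ℕ × ℕ → Fin 2 → ℕ =>
        ((fun q : {q : Fin 2 × ℕ × ℕ // q.2.1 ≤ n} => y q.1),
          fun q : Fin 2 × ℕ => y (q.1, n + 1, q.2)) := by fun_prop
    exact h.indep_init.comp measurable_id hψ
  have h2 : IndepFun a b μ := by
    have hd : Disjoint {q : Fin 2 × ℕ × ℕ | q.2.1 ≤ n} {q | q.2.1 = n + 1} :=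
      Set.disjoint_left.2 fun q (h1 : q.2.1 ≤ n) (h2 : q.2.1 = n + 1) => by omega
    have := indep_iSup_of_disjoint
      (m := fun q : Fin 2 × ℕ × ℕ => MeasurableSpace.comap (fun ω => X q.1 q.2.1 q.2.2 ω) inferInstance)
      (fun q => (h.measurable_offspring q.1 q.2.1 q.2.2).comap_le)
      h.indep_offspring hd
    have hb' := comap_pi_le_iSup (fun (q : Fin 2 × ℕ × ℕ) ω => X q.1 q.2.1 q.2.2 ω)
      (fun q : Fin 2 × ℕ => (q.1, n + 1, q.2)) (T := {q | q.2.1 = n + 1}) fun q => rfl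
    have ha' := comap_pi_le_iSup (fun (q : Fin 2 × ℕ × ℕ) ω => X q.1 q.2.1 q.2.2 ω)
      (fun q : {q : Fin 2 × ℕ × ℕ // q.2.1 ≤ n} => q.1) (T := {q | q.2.1 ≤ n}) fun q => q.2
    exact indep_of_indep_of_le_left (indep_of_indep_of_le_right this hb') ha'
  have h3 := indepFun_prodMk_left h.measurable_init ham hbm h1 h2
  refine indep_of_indep_of_le_left h3 (Measurable.comap_le ?_)
  have hpair := comap_measurable (m := inferInstance) (fun ω => (Z₀ ω, a ω))
  refine TwoType.measurable_size (measurable_fst.comp hpair) fun i m j hm => ?_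
  exact (measurable_pi_apply (⟨(i, m, j), hm⟩ : {q : Fin 2 × ℕ × ℕ // q.2.1 ≤ n})).comp
    (measurable_snd.comp hpair)

omit [IsProbabilityMeasure μ] in
theorem indepFun_size_score (n k : ℕ) :
    IndepFun (size Z₀ X n) (fun ω (q : Fin 2 × ℕ) => ζ q.1 k q.2 ω) μ := by
  have hψ : Measurable fun y : Fin 2 × ℕ × ℕ → ℝ =>
      fun q : Fin 2 × ℕ => y (q.1, k, q.2) := by fun_prop
  have h1 := h.indep_process.comp measurable_id hψ
  refine indep_of_indep_of_le_left h1 (Measurable.comap_le ?_)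
  have hpair := comap_measurable (m := inferInstance)
    (fun ω => (Z₀ ω, fun (q : Fin 2 × ℕ × ℕ) => X q.1 q.2.1 q.2.2 ω))
  exact TwoType.measurable_size (measurable_fst.comp hpair) fun i m j _ =>
    (measurable_pi_apply ((i, m, j) : Fin 2 × ℕ × ℕ)).comp (measurable_snd.comp hpair)

variable [∀ i, IsProbabilityMeasure (p i)]

omit [∀ i, IsProbabilityMeasure (p i)] in
theorem integrable_escape_size {q : Fin 2 → ℝ} (h0 : 0 ≤ q) (h1 : q ≤ 1) (n : ℕ) :
    Integrable (fun ω => escape (size Z₀ X n ω) q) μ := by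
  have := Measure.isProbabilityMeasure_map (μ := μ) (h.measurable_size n).aemeasurable
  exact (integrable_escape (m := μ.map (size Z₀ X n)) h0 h1).comp_measurable (h.measurable_size n)

/-- The branching property, in terms of generating functions. -/
theorem integral_escape_size_succ {q : Fin 2 → ℝ} (h0 : 0 ≤ q) (h1 : q ≤ 1) (n : ℕ) :
    ∫ ω, escape (size Z₀ X (n + 1) ω) q ∂μ = ∫ ω, escape (size Z₀ X n ω) (genMap p q) ∂μ := by
  set Y : Fin 2 → ℕ → Ω → ℝ := fun i j ω => 1 - escape (X i (n + 1) j ω) q with hY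
  have hg : 0 ≤ genMap p q ∧ genMap p q ≤ 1 := iterate_genMap_mem h0 h1 1
  have hψ : Measurable fun x : Fin 2 → ℕ => 1 - escape x q := .of_discrete
  have hYm : ∀ i j, Measurable (Y i j) := fun i j => hψ.comp (h.measurable_offspring i _ j)
  have hmean : ∀ i j, ∫ ω, Y i j ω ∂μ = 1 - genMap p q i := fun i j => by
    have e : ∫ ω, Y i j ω ∂μ = ∫ x, (1 - escape x q) ∂(p i) := by
      rw [← (h.law_offspring i (n + 1) j).map_eq,
        integral_map (h.measurable_offspring i _ j).aemeasurable (aestronglyMeasurable_vec _)]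
    rw [e, integral_sub (integrable_const _) (integrable_escape h0 h1)]
    simp [genMap, escapeMean]
  have hψ' : Measurable fun (y : Fin 2 × ℕ → Fin 2 → ℕ) (s : Fin 2 × ℕ) => 1 - escape (y s) q :=
    measurable_pi_iff.2 fun s => hψ.comp (measurable_pi_apply s)
  have hinj : Function.Injective fun s : Fin 2 × ℕ => (s.1, n + 1, s.2) := fun s t hst => by
    simp only [Prod.mk.injEq, true_and] at hst
    exact Prod.ext hst.1 hst.2
  have key := integral_mul_prod_range (μ := μ) (G := fun _ => 1) (h.measurable_size n) hYm
    (fun i j ω => sub_nonneg.2 (escape_le_one h1))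
    (fun i j ω => sub_le_self _ (escape_nonneg h0 h1))
    ((h.indepFun_size_offspring n).comp measurable_id hψ')
    ((h.indep_offspring.precomp hinj).comp (fun _ x => 1 - escape x q) fun _ => hψ)
    hmean (by simp)
  simp only [one_mul] at key
  have e1 : ∀ ω, ∏ i, ∏ j ∈ Finset.range (size Z₀ X n ω i), Y i j ω
      = 1 - escape (size Z₀ X (n + 1) ω) q := fun ω => by
    simp only [hY, escape, sub_sub_cancel, size, ← Finset.prod_pow_eq_pow_sum]
    rw [Finset.prod_comm]
    exact Finset.prod_congr rfl fun i _ => Finset.prod_comm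
  have e2 : ∀ ω, ∏ i, (1 - genMap p q i) ^ size Z₀ X n ω i
      = 1 - escape (size Z₀ X n ω) (genMap p q) := fun ω => by simp [escape]
  simp only [e1, e2] at key
  rw [integral_sub (integrable_const _) (h.integrable_escape_size h0 h1 _),
    integral_sub (integrable_const _) (h.integrable_escape_size hg.1 hg.2 _)] at key
  exact sub_right_injective key

theorem integral_escape_size {q : Fin 2 → ℝ} (h0 : 0 ≤ q) (h1 : q ≤ 1) (n : ℕ) :
    ∫ ω, escape (size Z₀ X n ω) q ∂μ = escapeMean (μ.map Z₀) ((genMap p)^[n] q) := by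
  induction n generalizing q with
  | zero =>
    rw [escapeMean, integral_map h.measurable_init.aemeasurable (aestronglyMeasurable_vec _)]
    rfl
  | succ n ih =>
    have hg : 0 ≤ genMap p q ∧ genMap p q ≤ 1 := iterate_genMap_mem h0 h1 1
    rw [h.integral_escape_size_succ h0 h1, ih hg.1 hg.2]
    rfl

omit h [IsProbabilityMeasure μ] [∀ i, IsProbabilityMeasure (p i)] in
theorem escape_one_right (x : Fin 2 → ℕ) : escape x 1 = if x = 0 then 0 else 1 := by
  split_ifs with hx
  · rw [hx, escape_zero_left]
  · obtain ⟨k, hk⟩ := Function.ne_iff.1 hx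
    have : ∏ k, (1 - (1 : Fin 2 → ℝ) k) ^ x k = 0 :=
      Finset.prod_eq_zero (Finset.mem_univ k) (by simpa using hk)
    rw [escape, this, sub_zero]

theorem measureReal_size_ne_zero (n : ℕ) :
    μ.real {ω | size Z₀ X n ω ≠ 0} = escapeMean (μ.map Z₀) (survival p n) := by
  have hm : MeasurableSet {ω | size Z₀ X n ω ≠ 0} :=
    (h.measurable_size n) (.of_discrete (s := {0}ᶜ))
  rw [survival, ← h.integral_escape_size zero_le_one le_rfl, ← integral_indicator_one hm]
  refine integral_congr_ae (.of_forall fun ω => ?_)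
  by_cases hz : size Z₀ X n ω = 0 <;> simp [escape_one_right, Set.indicator, hz]

/-- The probability that the process survives to generation `n` and all scores in a row of scores
are at most `y`. -/
theorem measureReal_score_le [∀ i, IsProbabilityMeasure (S i)] (n k : ℕ) (y : ℝ) :
    μ.real {ω | size Z₀ X n ω ≠ 0 ∧ ∀ i, ∀ j < size Z₀ X n ω i, ζ i k j ω ≤ y}
      = escapeMean (μ.map Z₀) (survival p n)
        - escapeMean (μ.map Z₀) ((genMap p)^[n] fun i => 1 - cdf (S i) y) := by
  classical
  set w : Fin 2 → ℝ := fun i => 1 - cdf (S i) y with hw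
  have w0 : 0 ≤ w := fun i => sub_nonneg.2 (cdf_le_one _ _)
  have w1 : w ≤ 1 := fun i => sub_le_self _ (cdf_nonneg _ _)
  set ψ : ℝ → ℝ := (Set.Iic y).indicator 1 with hψ_def
  have hψ : Measurable ψ := measurable_one.indicator measurableSet_Iic
  have hψ01 : ∀ t, 0 ≤ ψ t ∧ ψ t ≤ 1 := fun t => by
    by_cases ht : t ≤ y <;> simp [hψ_def, ht]
  have hψ' : Measurable fun (z : Fin 2 × ℕ → ℝ) (s : Fin 2 × ℕ) => ψ (z s) :=
    measurable_pi_iff.2 fun s => hψ.comp (measurable_pi_apply s)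
  have hinj : Function.Injective fun s : Fin 2 × ℕ => (s.1, k, s.2) := fun s t hst => by
    simp only [Prod.mk.injEq, true_and] at hst
    exact Prod.ext hst.1 hst.2
  have hmean : ∀ i j, ∫ ω, ψ (ζ i k j ω) ∂μ = cdf (S i) y := fun i j => by
    rw [cdf_eq_real, ← integral_indicator_one measurableSet_Iic, ← (h.law_score i k j).map_eq,
      integral_map (h.measurable_score i k j).aemeasurable hψ.aestronglyMeasurable]
  have key := integral_mul_prod_range (μ := μ) (Y := fun i j ω => ψ (ζ i k j ω))
    (G := fun z => escape z 1) (h.measurable_size n)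
    (fun i j => hψ.comp (h.measurable_score i k j)) (fun _ _ _ => (hψ01 _).1)
    (fun _ _ _ => (hψ01 _).2) ((h.indepFun_size_score n k).comp measurable_id hψ')
    ((h.indep_score.precomp hinj).comp (fun _ => ψ) fun _ => hψ) hmean
    (fun z => by rw [escape_one_right]; split_ifs <;> simp)
  have e2 : ∀ ω, escape (size Z₀ X n ω) 1 * ∏ i, cdf (S i) y ^ size Z₀ X n ω i
      = escape (size Z₀ X n ω) 1 - escape (size Z₀ X n ω) w := fun ω => by
    rw [escape_one_right]
    split_ifs with hz
    · rw [hz, escape_zero_left]; simp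
    · simp [escape, hw]
  simp only [e2] at key
  rw [integral_sub (h.integrable_escape_size zero_le_one le_rfl n)
    (h.integrable_escape_size w0 w1 n), h.integral_escape_size zero_le_one le_rfl,
    h.integral_escape_size w0 w1] at key
  rw [survival, ← key]
  set E := {ω | size Z₀ X n ω ≠ 0 ∧ ∀ i, ∀ j < size Z₀ X n ω i, ζ i k j ω ≤ y} with hE
  have hEm : MeasurableSet E := by
    have : Measurable fun ω => (size Z₀ X n ω, fun s : Fin 2 × ℕ => ζ s.1 k s.2 ω) :=
      (h.measurable_size n).prodMk (measurable_pi_iff.2 fun s => h.measurable_score _ _ _)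
    have hA : Measurable fun a : (Fin 2 → ℕ) × (Fin 2 × ℕ → ℝ) =>
        a.1 ≠ 0 ∧ ∀ i, ∀ j < a.1 i, a.2 (i, j) ≤ y :=
      measurable_from_prod_countable_right fun z => by
        have hle : ∀ i j, Measurable fun a : Fin 2 × ℕ → ℝ => a (i, j) ≤ y := fun i j =>
          measurableSet_setOfPred.1 (measurableSet_le (measurable_pi_apply (i, j)) measurable_const)
        exact (measurable_const (a := z ≠ 0)).and (Measurable.forall fun i => Measurable.forall fun j =>
          (measurable_const (a := j < z i)).imp (hle i j))
    exact measurableSet_setOfPred.2 (hA.comp this)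
  rw [← integral_indicator_one hEm]
  refine integral_congr_ae (.of_forall fun ω => ?_)
  simp only [escape_one_right]
  split_ifs with hz
  · simp [hE, Set.indicator, hz]
  · rw [one_mul]
    by_cases ha : ∀ i, ∀ j < size Z₀ X n ω i, ζ i k j ω ≤ y
    · have : ω ∈ E := ⟨hz, ha⟩
      rw [Set.indicator_of_mem this, Pi.one_apply]
      refine (Finset.prod_eq_one fun i _ => Finset.prod_eq_one fun j hj => ?_).symm
      simp [hψ_def, ha i j (Finset.mem_range.1 hj)]
    · have : ω ∉ E := fun hω => ha hω.2
      rw [Set.indicator_of_notMem this]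
      push Not at ha
      obtain ⟨i, j, hj, hlt⟩ := ha
      refine (Finset.prod_eq_zero (Finset.mem_univ i)
        (Finset.prod_eq_zero (Finset.mem_range.2 hj) ?_)).symm
      simp [hψ_def, hlt]

end IsScoredProcess

end TwoType

namespace TwoType

section powers

variable {f t : ℕ → ℝ}

theorem tendsto_mul_one_sub_of_rpow {c : ℝ} (hf0 : ∀ n, 0 ≤ f n) (ht : Tendsto t atTop atTop)
    (h : Tendsto (fun n => f n ^ t n) atTop (𝓝 (Real.exp (-c)))) :
    Tendsto f atTop (𝓝 1) ∧ Tendsto (fun n => t n * (1 - f n)) atTop (𝓝 c) := by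
  have hpos : ∀ᶠ n in atTop, 0 < f n := by
    filter_upwards [h.eventually_const_lt (Real.exp_pos _), ht.eventually_gt_atTop 0] with n hn ht0
    refine (hf0 n).lt_of_ne' fun hz => hn.ne' ?_
    rw [hz, Real.zero_rpow ht0.ne']
  have hlog : Tendsto (fun n => t n * Real.log (f n)) atTop (𝓝 (-c)) := by
    have := h.log (Real.exp_pos _).ne'
    rw [Real.log_exp] at this
    refine this.congr' ?_
    filter_upwards [hpos] with n hn using Real.log_rpow hn _
  have hlog0 : Tendsto (fun n => Real.log (f n)) atTop (𝓝 0) := by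
    have := hlog.mul (tendsto_inv_atTop_zero.comp ht)
    rw [mul_zero] at this
    refine this.congr' ?_
    filter_upwards [ht.eventually_gt_atTop 0] with n hn
    simp only [Function.comp]
    field_simp
  have hf1 : Tendsto f atTop (𝓝 1) := by
    have := (Real.continuous_exp.tendsto 0).comp hlog0
    rw [Real.exp_zero] at this
    refine this.congr' ?_
    filter_upwards [hpos] with n hn using Real.exp_log hn
  have hup := hlog.neg
  rw [neg_neg] at hup
  have hlow := hf1.mul hup
  rw [one_mul] at hlow
  refine ⟨hf1, tendsto_of_tendsto_of_tendsto_of_le_of_le' hlow hup ?_ ?_⟩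
  · filter_upwards [hpos, ht.eventually_gt_atTop 0] with n hn ht0
    have h1 := Real.one_sub_inv_le_log_of_pos hn
    have h2 : f n - 1 ≤ f n * Real.log (f n) := by
      have := mul_le_mul_of_nonneg_left h1 hn.le
      rwa [mul_sub, mul_one, mul_inv_cancel₀ hn.ne'] at this
    nlinarith
  · filter_upwards [hpos, ht.eventually_gt_atTop 0] with n hn ht0
    nlinarith [Real.log_le_sub_one_of_pos hn]

theorem tendsto_mul_one_sub_atTop_of_rpow (ht : Tendsto t atTop atTop)
    (h : Tendsto (fun n => f n ^ t n) atTop (𝓝 0)) :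
    Tendsto (fun n => t n * (1 - f n)) atTop atTop := by
  refine tendsto_atTop.2 fun K => ?_
  filter_upwards [h.eventually_lt_const (Real.exp_pos (-(2 * |K|))),
    ht.eventually_gt_atTop (2 * |K|)] with n hn htn
  by_contra! hlt
  have hK := abs_nonneg K
  have ht0 : 0 < t n := by linarith
  have hle : t n * (1 - f n) ≤ |K| := hlt.le.trans (le_abs_self K)
  have hf : 1 / 2 ≤ f n := by
    by_contra! hf
    nlinarith
  have hf0 : 0 < f n := by linarith
  refine hn.not_ge ?_
  rw [Real.rpow_def_of_pos hf0, Real.exp_le_exp]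
  have h1 := Real.one_sub_inv_le_log_of_pos hf0
  have h2 : f n - 1 ≤ f n * Real.log (f n) := by
    have := mul_le_mul_of_nonneg_left h1 hf0.le
    rwa [mul_sub, mul_one, mul_inv_cancel₀ hf0.ne'] at this
  by_contra! hcon
  nlinarith

end powers

section tails

variable {F G : ℝ → ℝ}

theorem coe_lt_rightEndpoint_iff (hF : Monotone F) (hFc : Continuous F) {y : ℝ} :
    (y : EReal) < rightEndpoint F ↔ F y < 1 := by
  constructor
  · intro hy
    obtain ⟨_, ⟨z, hz, rfl⟩, hyz⟩ := lt_sSup_iff.1 hy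
    exact (hF (EReal.coe_lt_coe_iff.1 hyz).le).trans_lt hz
  · intro hy
    obtain ⟨z, hz, hyz⟩ := (((hFc.tendsto y).mono_left (nhdsWithin_le_nhds
      (s := Set.Ioi y))).eventually_lt_const hy |>.and eventually_mem_nhdsWithin).exists
    exact (EReal.coe_lt_coe_iff.2 hyz).trans_le (le_sSup ⟨z, hz, rfl⟩)

theorem TailEquivalent.tendsto_mul_one_sub {A : ℝ} (h : TailEquivalent F G A) (hF : Monotone F)
    (hFc : Continuous F) (hG : Monotone G) (hGc : Continuous G) (hF1 : ∀ y, F y ≤ 1)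
    (hG1 : ∀ y, G y ≤ 1) {y t : ℕ → ℝ} {c : ℝ} (hy : Tendsto (fun n => F (y n)) atTop (𝓝 1))
    (ht : Tendsto (fun n => t n * (1 - F (y n))) atTop (𝓝 c)) :
    Tendsto (fun n => t n * (1 - G (y n))) atTop (𝓝 (A⁻¹ * c)) := by
  classical
  set L := atTop ⊓ 𝓟 {n | ¬F (y n) = 1}
  have hlt : ∀ᶠ n in L, F (y n) < 1 :=
    eventually_inf_principal.2 (.of_forall fun n hn => (hF1 _).lt_of_ne hn)
  have hyL : Tendsto y L (comap (fun x : ℝ => (x : EReal)) (𝓝[<] rightEndpoint F)) := by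
    refine tendsto_comap_iff.2 (tendsto_nhdsWithin_iff.2 ⟨?_, ?_⟩)
    · refine tendsto_order.2 ⟨fun b hb => ?_, fun b hb => ?_⟩
      · obtain ⟨_, ⟨z, hz, rfl⟩, hbz⟩ := lt_sSup_iff.1 hb
        filter_upwards [(hy.mono_left (inf_le_left : L ≤ _)).eventually_const_lt hz] with n hn
        exact hbz.trans (EReal.coe_lt_coe_iff.2 (hF.reflect_lt hn))
      · filter_upwards [hlt] with n hn
        exact ((coe_lt_rightEndpoint_iff hF hFc).2 hn).trans hb
    · filter_upwards [hlt] with n hn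
      exact (coe_lt_rightEndpoint_iff hF hFc).2 hn
  have hratio : Tendsto (fun n => if F (y n) = 1 then A⁻¹
      else ((1 - F (y n)) / (1 - G (y n)))⁻¹) atTop (𝓝 A⁻¹) :=
    tendsto_const_nhds.if ((h.tendsto.comp hyL).inv₀ h.pos.ne')
  refine (hratio.mul ht).congr fun n => ?_
  split_ifs with h1
  · have h2 : G (y n) = 1 := by
      refine (hG1 _).antisymm (not_lt.1 fun hlt => ?_)
      rw [← coe_lt_rightEndpoint_iff hG hGc, ← h.endpoint, coe_lt_rightEndpoint_iff hF hFc] at hlt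
      exact hlt.ne h1
    rw [h1, h2]
    simp
  · have : 1 - F (y n) ≠ 0 := sub_ne_zero.2 (Ne.symm h1)
    rw [inv_div]
    field_simp

end tails

section exponent

variable {A x : ℝ} {θ : EReal}

theorem evExponent_tail (hA : 0 < A) (hθ : θ ≠ 0) :
    evExponent (tailScale A θ * x + tailShift A θ) θ = ENNReal.ofReal A⁻¹ * evExponent x θ := by
  by_cases hinf : θ = ⊤ ∨ θ = ⊥
  · simp only [evExponent, tailScale, tailShift, if_pos hinf]
    rw [← ENNReal.ofReal_mul (inv_nonneg.2 hA.le), ← Real.exp_log hA, ← Real.exp_neg,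
      ← Real.exp_add, Real.log_exp]
    congr 2
    ring
  · have hθ' : θ.toReal ≠ 0 := by
      push Not at hinf
      simp [EReal.toReal_eq_zero_iff, hθ, hinf.1, hinf.2]
    simp only [evExponent, tailScale, tailShift, if_neg hinf]
    have hs : 0 < A ^ (1 / θ.toReal) := Real.rpow_pos_of_pos hA _
    have e : 1 + (A ^ (1 / θ.toReal) * x + θ.toReal * (A ^ (1 / θ.toReal) - 1)) / θ.toReal
        = A ^ (1 / θ.toReal) * (1 + x / θ.toReal) := by
      field_simp
      ring
    have e2 : ENNReal.ofReal (A ^ (1 / θ.toReal)) ^ (-θ.toReal) = ENNReal.ofReal A⁻¹ := by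
      rw [ENNReal.ofReal_rpow_of_pos hs, ← Real.rpow_mul hA.le, ← Real.rpow_neg_one]
      congr 2
      field_simp
    rw [e, ENNReal.ofReal_mul hs.le, ← e2,
      ENNReal.mul_rpow_of_ne_top ENNReal.ofReal_ne_top ENNReal.ofReal_ne_top]

theorem limitCDF_of_eq_top {r : ℝ} (h : evExponent x θ = ∞) : limitCDF A r θ x = 0 := by
  simp [limitCDF, h]

theorem limitCDF_of_ne_top {r : ℝ} (hA : 0 < A) (hθ : θ ≠ 0) (hr : 0 ≤ r)
    (h : evExponent x θ ≠ ∞) :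
    limitCDF A r θ x = 1 / (1 + (evExponent x θ).toReal + r * (A⁻¹ * (evExponent x θ).toReal)) := by
  have h1 : ENNReal.ofReal r * (ENNReal.ofReal A⁻¹ * evExponent x θ) ≠ ∞ :=
    ENNReal.mul_ne_top ENNReal.ofReal_ne_top (ENNReal.mul_ne_top ENNReal.ofReal_ne_top h)
  rw [limitCDF, evExponent_tail hA hθ, ENNReal.toReal_div, ENNReal.toReal_add (by simp [h]) h1,
    ENNReal.toReal_add (by simp) h, ENNReal.toReal_mul, ENNReal.toReal_mul,
    ENNReal.toReal_ofReal hr, ENNReal.toReal_ofReal (inv_nonneg.2 hA.le), ENNReal.toReal_one]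

end exponent

end TwoType

namespace TwoType

variable {p : Fin 2 → Measure (Fin 2 → ℕ)} {u v : Fin 2 → ℝ}

namespace IsCritical

variable (h : IsCritical p u v) [∀ i, IsProbabilityMeasure (p i)]
include h

section initial

variable {m : Measure (Fin 2 → ℕ)} [IsProbabilityMeasure m]
  (hm : ∀ k, Integrable (fun x : Fin 2 → ℕ => (x k : ℝ)) m) (hm0 : ∀ᵐ x ∂m, x ≠ 0)
include hm

include hm0 in
omit [∀ i, IsProbabilityMeasure (p i)] in
theorem mean_dot_pos : 0 < ∑ k, (∫ x, (x k : ℝ) ∂m) * u k := by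
  have hnn : ∀ k, 0 ≤ ∫ x, (x k : ℝ) ∂m := fun k => integral_nonneg fun x => Nat.cast_nonneg _
  refine (Finset.sum_nonneg fun k _ => mul_nonneg (hnn k) (h.right_pos k).le).lt_of_ne' fun hz => ?_
  rw [Finset.sum_eq_zero_iff_of_nonneg fun k _ => mul_nonneg (hnn k) (h.right_pos k).le] at hz
  have hz' : ∀ k, ∀ᵐ x ∂m, x k = 0 := fun k => by
    have := (mul_eq_zero.1 (hz k (Finset.mem_univ k))).resolve_right (h.right_pos k).ne'
    rw [integral_eq_zero_iff_of_nonneg (fun x => Nat.cast_nonneg _) (hm k)] at this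
    filter_upwards [this] with x hx
    simpa using hx
  obtain ⟨x, hx, hx0⟩ := ((ae_all_iff.2 hz').and hm0).exists
  exact hx0 (funext hx)

omit [IsProbabilityMeasure m] in
theorem tendsto_nat_mul_escapeMean_survival :
    Tendsto (fun n : ℕ => n * escapeMean m (survival p n)) atTop
      (𝓝 ((halfVariance p u v)⁻¹ * ∑ k, (∫ x, (x k : ℝ) ∂m) * u k)) := by
  refine (tendsto_nat_mul_escapeMean hm h.tendsto_nat_mul_survival
    (fun n => (survival_mem n).1) fun n => (survival_mem n).2).trans_eq ?_
  rw [Finset.mul_sum]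
  exact congrArg 𝓝 (Finset.sum_congr rfl fun k _ => by simp; ring)

include hm0

theorem eventually_escapeMean_survival_pos :
    ∀ᶠ n in atTop, 0 < escapeMean m (survival p n) := by
  have hs := mul_pos (inv_pos.2 h.halfVariance_pos) (h.mean_dot_pos hm hm0)
  filter_upwards [(h.tendsto_nat_mul_escapeMean_survival hm).eventually_const_lt hs] with n hn
  exact pos_of_mul_pos_right hn n.cast_nonneg

theorem tendsto_escapeMean_survival_div_succ :
    Tendsto (fun n => escapeMean m (survival p n) / escapeMean m (survival p (n + 1))) atTop
      (𝓝 1) := by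
  have hs := mul_pos (inv_pos.2 h.halfVariance_pos) (h.mean_dot_pos hm hm0)
  have h1 := h.tendsto_nat_mul_escapeMean_survival hm
  have h2 := (tendsto_add_atTop_iff_nat 1).2 h1
  have h3 : Tendsto (fun n : ℕ => 1 + 1 / (n : ℝ)) atTop (𝓝 1) := by
    simpa using (tendsto_one_div_atTop_nhds_zero_nat (𝕜 := ℝ)).const_add 1
  have h4 := (h1.div h2 hs.ne').mul h3
  rw [div_self hs.ne', mul_one] at h4
  refine h4.congr' ?_
  filter_upwards [eventually_gt_atTop 0, (tendsto_add_atTop_iff_nat 1).2 tendsto_id |>.eventually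
    (h.eventually_escapeMean_survival_pos hm hm0)] with n hn hpos
  simp only [Pi.div_apply, id] at hpos ⊢
  push_cast
  field_simp

theorem tendsto_escapeMean_ratio {w : ℕ → Fin 2 → ℝ} {c : ℝ}
    (h0 : ∀ n, 0 ≤ w n) (h1 : ∀ n, w n ≤ 1)
    (hw : Tendsto (fun n : ℕ => (n : ℝ) • (genMap p)^[n] (w n)) atTop (𝓝 (c • u))) :
    Tendsto (fun n => (escapeMean m (survival p n) - escapeMean m ((genMap p)^[n] (w n)))
      / escapeMean m (survival p n)) atTop (𝓝 (1 - halfVariance p u v * c)) := by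
  have hB := h.halfVariance_pos
  have hs := h.mean_dot_pos hm hm0
  have h2 := tendsto_nat_mul_escapeMean hm hw (fun n => (iterate_genMap_mem (h0 n) (h1 n) n).1)
    fun n => (iterate_genMap_mem (h0 n) (h1 n) n).2
  have h3 := (h2.div (h.tendsto_nat_mul_escapeMean_survival hm)
    (mul_pos (inv_pos.2 hB) hs).ne').const_sub 1
  have e : ∑ k, (∫ x, (x k : ℝ) ∂m) * (c • u) k = c * ∑ k, (∫ x, (x k : ℝ) ∂m) * u k := by
    rw [Finset.mul_sum]
    exact Finset.sum_congr rfl fun k _ => by simp; ring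
  rw [e] at h3
  have e2 : 1 - c * (∑ k, (∫ x, (x k : ℝ) ∂m) * u k)
      / ((halfVariance p u v)⁻¹ * ∑ k, (∫ x, (x k : ℝ) ∂m) * u k) = 1 - halfVariance p u v * c := by
    field_simp
  rw [e2] at h3
  refine h3.congr' ?_
  filter_upwards [h.eventually_escapeMean_survival_pos hm hm0, eventually_gt_atTop 0]
    with n hn hn0
  simp only [Pi.div_apply]
  field_simp

/-- The limit of the conditional probability that all scores are below a level, by the shape of
the level sequence. -/
theorem tendsto_limitCDF {S : Fin 2 → Measure ℝ} [∀ i, IsProbabilityMeasure (S i)]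
    (hcont : ∀ i, Continuous (cdf (S i))) {A : ℝ}
    (htail : TailEquivalent (cdf (S 0)) (cdf (S 1)) A) {θ : EReal} (hθ : θ ≠ 0) {a b : ℝ → ℝ}
    (hattr : Attracts (cdf (S 0)) θ a b) (x : ℝ) {t : ℕ → ℝ}
    (ht : Tendsto (fun n => t n / n) atTop (𝓝 (v 0 * halfVariance p u v))) :
    Tendsto (fun n => (escapeMean m (survival p n)
        - escapeMean m ((genMap p)^[n] fun i => 1 - cdf (S i) (a (t n) * x + b (t n))))
      / escapeMean m (survival p n)) atTop (𝓝 (limitCDF A (v 1 / v 0) θ x)) := by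
  have hB := h.halfVariance_pos
  set B := halfVariance p u v with hB_def
  have hv0 := h.left_pos 0
  have hv1 := h.left_pos 1
  have hτ : 0 < v 0 * B := mul_pos hv0 hB
  have htop : Tendsto t atTop atTop := by
    refine (ht.pos_mul_atTop hτ tendsto_natCast_atTop_atTop).congr' ?_
    filter_upwards [eventually_gt_atTop 0] with n hn
    field_simp
  set w : ℕ → Fin 2 → ℝ := fun n i => 1 - cdf (S i) (a (t n) * x + b (t n)) with hw_def
  have w0 : ∀ n, 0 ≤ w n := fun n i => sub_nonneg.2 (cdf_le_one _ _)
  have w1 : ∀ n, w n ≤ 1 := fun n i => sub_le_self _ (cdf_nonneg _ _)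
  have hF := (hattr.tendsto x).comp htop
  have hscale : ∀ i, ∀ᶠ n : ℕ in atTop, t n * w n i * (t n / n)⁻¹ = n * w n i := fun i => by
    filter_upwards [eventually_gt_atTop 0, htop.eventually_gt_atTop 0] with n hn hn0
    field_simp
  have hinv := ht.inv₀ hτ.ne'
  by_cases hη : evExponent x θ = ∞
  · rw [limitCDF_of_eq_top hη]
    rw [evCDF, if_pos hη] at hF
    have h1 := ((tendsto_mul_one_sub_atTop_of_rpow htop hF).atTop_mul_pos (inv_pos.2 hτ)
      hinv).congr' (hscale 0)
    have := h.tendsto_escapeMean_ratio hm hm0 w0 w1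
      (h.tendsto_nat_mul_iterate_self_of_atTop h1 w0 w1)
    rwa [mul_inv_cancel₀ hB.ne', sub_self] at this
  · rw [limitCDF_of_ne_top htail.pos hθ (div_pos hv1 hv0).le hη]
    rw [evCDF, if_neg hη] at hF
    set η := (evExponent x θ).toReal with hη_def
    have hη0 : 0 ≤ η := ENNReal.toReal_nonneg
    obtain ⟨hF1, hF2⟩ := tendsto_mul_one_sub_of_rpow (fun n => cdf_nonneg _ _) htop hF
    have hG := htail.tendsto_mul_one_sub (monotone_cdf _) (hcont 0) (monotone_cdf _) (hcont 1)
      (cdf_le_one _) (cdf_le_one _) hF1 hF2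
    have hwlim : Tendsto (fun n : ℕ => (n : ℝ) • w n) atTop
        (𝓝 ![η * (v 0 * B)⁻¹, A⁻¹ * η * (v 0 * B)⁻¹]) :=
      tendsto_pi_nhds.2 (Fin.forall_fin_two.2
        ⟨(hF2.mul hinv).congr' (hscale 0), (hG.mul hinv).congr' (hscale 1)⟩)
    refine (h.tendsto_escapeMean_ratio hm hm0 w0 w1
      (h.tendsto_nat_mul_iterate_self hwlim w0 w1)).trans_eq ?_
    have hA := htail.pos
    have hκ : v ⬝ᵥ ![η * (v 0 * B)⁻¹, A⁻¹ * η * (v 0 * B)⁻¹]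
        = (η + v 1 / v 0 * (A⁻¹ * η)) / B := by
      simp only [dotProduct, Fin.sum_univ_two, Matrix.cons_val_zero, Matrix.cons_val_one]
      field_simp
    have hnn : 0 ≤ v 1 / v 0 * (A⁻¹ * η) := by positivity
    rw [hκ]
    congr 1
    generalize v 1 / v 0 * (A⁻¹ * η) = ξ at hnn ⊢
    rw [← hB_def, mul_div_cancel₀ _ hB.ne']
    have : (0 : ℝ) < 1 + (η + ξ) := by positivity
    have : (0 : ℝ) < 1 + η + ξ := by positivity
    field_simp
    ring

end initial

end IsCritical

section maxScore

variable {Ω : Type*} {ζ : Fin 2 → ℕ → ℕ → Ω → ℝ}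

theorem maxScore_le_iff {k : ℕ} {N : Fin 2 → ℕ} {ω : Ω} {y : ℝ} (hN : N ≠ 0) :
    maxScore ζ k N ω ≤ y ↔ ∀ i, ∀ j < N i, ζ i k j ω ≤ y := by
  obtain ⟨i₀, hi₀⟩ := Function.ne_iff.1 hN
  have hne : {y | ∃ i, ∃ j < N i, y = ζ i k j ω}.Nonempty :=
    ⟨_, i₀, 0, Nat.pos_of_ne_zero hi₀, rfl⟩
  have hfin : {y | ∃ i, ∃ j < N i, y = ζ i k j ω}.Finite := by
    have : {y | ∃ i, ∃ j < N i, y = ζ i k j ω}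
        = ⋃ i, (fun j => ζ i k j ω) '' Set.Iio (N i) := by
      ext y
      simp [eq_comm]
    rw [this]
    exact Set.finite_iUnion fun i => (Set.finite_Iio _).image _
  rw [maxScore, csSup_le_iff hfin.bddAbove hne]
  constructor
  · exact fun H i j hj => H _ ⟨i, j, hj, rfl⟩
  · rintro H _ ⟨i, j, hj, rfl⟩
    exact H i j hj

theorem size_succ_eq_zero {Z₀ : Ω → Fin 2 → ℕ} {X : Fin 2 → ℕ → ℕ → Ω → Fin 2 → ℕ} {n : ℕ}
    {ω : Ω} (h : size Z₀ X n ω = 0) : size Z₀ X (n + 1) ω = 0 := by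
  ext k
  simp [size, h]

end maxScore

end TwoType

theorem theorem13 {Ω : Type*} [MeasurableSpace Ω] (μ : Measure Ω) [IsProbabilityMeasure μ]
    (p : Fin 2 → Measure (Fin 2 → ℕ)) [∀ i, IsProbabilityMeasure (p i)]
    (S : Fin 2 → Measure ℝ) [∀ i, IsProbabilityMeasure (S i)]
    (Z₀ : Ω → Fin 2 → ℕ) (X : Fin 2 → ℕ → ℕ → Ω → Fin 2 → ℕ) (ζ : Fin 2 → ℕ → ℕ → Ω → ℝ)
    (hproc : TwoType.IsScoredProcess μ p S Z₀ X ζ)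
    (u v : Fin 2 → ℝ) (hcrit : TwoType.IsCritical p u v)
    (hnonneg : ∀ i, ∀ᵐ y ∂(S i), 0 ≤ y) (hcont : ∀ i, Continuous (cdf (S i)))
    (A : ℝ) (htail : TwoType.TailEquivalent (cdf (S 0)) (cdf (S 1)) A)
    (θ : EReal) (hθ : θ ≠ 0) (a b : ℝ → ℝ) (hattr : TwoType.Attracts (cdf (S 0)) θ a b)
    (B : ℝ) (hB : B = TwoType.halfVariance p u v) (x : ℝ) :
    Tendsto (fun n : ℕ => (cond μ {ω | TwoType.size Z₀ X n ω ≠ 0}).real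
        {ω | (TwoType.maxScore ζ n (TwoType.size Z₀ X n ω) ω - b (v 0 * B * n))
          / a (v 0 * B * n) ≤ x})
      atTop (𝓝 (TwoType.limitCDF A (v 1 / v 0) θ x)) ∧
    Tendsto (fun n : ℕ => (cond μ {ω | TwoType.size Z₀ X n ω ≠ 0}).real
        {ω | (TwoType.maxScore ζ n (TwoType.size Z₀ X (n - 1) ω) ω - b (v 0 * B * n))
          / a (v 0 * B * n) ≤ x})
      atTop (𝓝 (TwoType.limitCDF A (v 1 / v 0) θ x)) := by
  set m := μ.map Z₀
  have : IsProbabilityMeasure m :=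
    Measure.isProbabilityMeasure_map hproc.measurable_init.aemeasurable
  have hm : ∀ k, Integrable (fun x : Fin 2 → ℕ => (x k : ℝ)) m := fun k =>
    (integrable_map_measure (TwoType.aestronglyMeasurable_vec _)
      hproc.measurable_init.aemeasurable).2 (hproc.init_integrable k)
  have hm0 : ∀ᵐ x ∂m, x ≠ 0 :=
    (ae_map_iff hproc.measurable_init.aemeasurable .of_discrete).2 hproc.init_ne_zero
  have hτ : 0 < v 0 * B := by rw [hB]; exact mul_pos (hcrit.left_pos 0) hcrit.halfVariance_pos
  have hapos : ∀ᶠ n : ℕ in atTop, 0 < a (v 0 * B * n) :=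
    (tendsto_natCast_atTop_atTop.const_mul_atTop hτ).eventually hattr.pos
  have hsurv := hproc.measureReal_size_ne_zero
  have hrow := hproc.measureReal_score_le
  have hmeas : ∀ n, MeasurableSet {ω | TwoType.size Z₀ X n ω ≠ 0} := fun n =>
    (hproc.measurable_size n) (.of_discrete (s := {0}ᶜ))
  have hcond : ∀ n s, (cond μ {ω | TwoType.size Z₀ X n ω ≠ 0}).real s
      = μ.real ({ω | TwoType.size Z₀ X n ω ≠ 0} ∩ s)
        / μ.real {ω | TwoType.size Z₀ X n ω ≠ 0} := fun n s => by
    rw [measureReal_def, cond_apply (hmeas n), ENNReal.toReal_mul, ENNReal.toReal_inv,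
      div_eq_inv_mul, measureReal_def, measureReal_def]
  have hscaled : ∀ (n : ℕ) (N : Fin 2 → ℕ) (ω : Ω), 0 < a (v 0 * B * n) → N ≠ 0 →
      ((TwoType.maxScore ζ n N ω - b (v 0 * B * n)) / a (v 0 * B * n) ≤ x ↔
        ∀ i, ∀ j < N i, ζ i n j ω ≤ a (v 0 * B * n) * x + b (v 0 * B * n)) := fun n N ω ha hN => by
    rw [div_le_iff₀ ha, sub_le_iff_le_add, mul_comm x, TwoType.maxScore_le_iff hN]
  constructor
  · have ht : Tendsto (fun n : ℕ => v 0 * B * n / n) atTop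
        (𝓝 (v 0 * TwoType.halfVariance p u v)) := by
      rw [← hB]
      refine tendsto_const_nhds.congr' ?_
      filter_upwards [eventually_gt_atTop 0] with n hn
      field_simp
    refine (hcrit.tendsto_limitCDF hm hm0 hcont htail hθ hattr x ht).congr' ?_
    filter_upwards [hapos] with n ha
    rw [hcond, hsurv, ← hrow n n]
    congr 2
    ext ω
    exact and_congr_right fun hω => (hscaled n _ ω ha hω).symm
  · rw [← tendsto_add_atTop_iff_nat 1]
    have ht : Tendsto (fun n : ℕ => v 0 * B * ((n + 1 : ℕ) : ℝ) / n) atTop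
        (𝓝 (v 0 * TwoType.halfVariance p u v)) := by
      rw [← hB]
      have h3 : Tendsto (fun n : ℕ => v 0 * B * (1 + 1 / (n : ℝ))) atTop (𝓝 (v 0 * B)) := by
        simpa using ((tendsto_one_div_atTop_nhds_zero_nat (𝕜 := ℝ)).const_add 1).const_mul (v 0 * B)
      refine h3.congr' ?_
      filter_upwards [eventually_gt_atTop 0] with n hn
      push_cast
      field_simp
    have hlim := hcrit.tendsto_limitCDF hm hm0 hcont htail hθ hattr x ht
    have hq := hcrit.tendsto_escapeMean_survival_div_succ hm hm0
    have hup := hlim.mul hq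
    have hlow := hup.sub (hq.sub_const 1)
    rw [mul_one] at hup hlow
    rw [sub_self, sub_zero] at hlow
    refine tendsto_of_tendsto_of_tendsto_of_le_of_le' hlow hup ?_ ?_
    all_goals
      filter_upwards [(tendsto_add_atTop_nat 1).eventually hapos,
        hcrit.eventually_escapeMean_survival_pos hm hm0,
        (tendsto_add_atTop_nat 1).eventually
          (hcrit.eventually_escapeMean_survival_pos hm hm0)] with n ha hpos hpos'
      have hsub : {ω | TwoType.size Z₀ X (n + 1) ω ≠ 0} ⊆ {ω | TwoType.size Z₀ X n ω ≠ 0} :=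
        fun ω hω hz => hω (TwoType.size_succ_eq_zero hz)
      rw [hcond, hsurv, Nat.add_sub_cancel, div_mul_div_cancel₀ hpos.ne', ← hrow n (n + 1)]
    · rw [div_sub_one hpos'.ne', ← sub_div]
      refine div_le_div_of_nonneg_right ?_ hpos'.le
      rw [← hsurv, ← hsurv (n + 1), ← measureReal_sdiff hsub (hmeas _), sub_le_iff_le_add]
      refine (measureReal_mono fun ω hω => ?_).trans (measureReal_union_le _ _)
      by_cases hz : TwoType.size Z₀ X (n + 1) ω = 0
      · exact Or.inr ⟨hω.1, not_not.2 hz⟩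
      · exact Or.inl ⟨hz, (hscaled (n + 1) _ ω ha hω.1).2 hω.2⟩
    · refine div_le_div_of_nonneg_right (measureReal_mono fun ω hω => ?_) hpos'.le
      exact ⟨hsub hω.1, (hscaled (n + 1) _ ω ha (hsub hω.1)).1 hω.2⟩
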